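/- Let $n\ge 2$. For a non-negative, bounded, compactly supported Borel measurable function $f:\mathbb{R}^n\to\mathbb{R}$, let $I(f)\subset\mathbb{R}^n$ be the star-shaped set $I(f)=\{r\theta : \theta\in\mathbb{S}^{n-1},\ 0\le r\le \rho_{I(f)}(\theta)\}$ with $\rho_{I(f)}(\theta)=\int_{\theta^\perp} f(y)\,dy$, integration being with respect to $(n-1)$-dimensional Lebesgue measure on the hyperplane $\theta^\perp$. Let $$\overline{\mathcal I}_0(f)=\limsup_{p\to-1^+}\frac{p+1}{n}\int_{\mathbb{R}^n}\cdots\int_{\mathbb{R}^n}\Delta(x_1,\dots,x_n)^p f(x_1)\cdots f(x_n)\,dx_1\cdots dx_n,$$ where $\Delta(x_1,\dots,x_n)$ is the $n$-dimensional volume of the parallelotope spanned by $x_1,\dots,x_n$, let $\underline{\mathcal I}_0(f)$ be the corresponding $\liminf$, and, when the limit exists, let $\mathcal I_0(f)$ be its value. For a compact set $K\subset\mathbb{R}^n$ write $IK=I(1_K)$, $\overline{\mathcal I}_0(K)=\overline{\mathcal I}_0(1_K)$ and $\mathcal I_0(K)=\mathcal I_0(1_K)$, and say that $K$ has radially negligible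 boundary if $\int_{\mathbb{S}^{n-1}}|\partial K\cap\mathbb{R}_+u|_1\,d\sigma(u)=0$, where $|\cdot|_1$ is one-dimensional Hausdorff measure, $\mathbb{R}_+=[0,\infty)$ and $\sigma$ is the rotation invariant probability measure on $\mathbb{S}^{n-1}$. Write $|\cdot|$ for Lebesgue measure on $\mathbb{R}^n$. Let $f$ be a non-negative, bounded, compactly supported Borel measurable function on $\mathbb{R}^n$. 1. If $f$ is lower semicontinuous, then $|I(f)|\le\underline{\mathcal I}_0(f)$. 2. If $f$ is upper semicontinuous, then $|I(f)|\ge\overline{\mathcal I}_0(f)$. 3. In particular, if $K\subset\mathbb{R}^n$ is compact, then $|IK|\ge\overline{\mathcal I}_0(K)$; and if $f$ is continuous, then the limit defining $\mathcal I_0(f)$ exists, is finite, and $|I(f)|=\mathcal I_0(f)$. 4. If $K\subset\mathbb{R}^n$ is compact with radially negligible boundary, then the limit defining $\mathcal I_0(K)$ exists, is finite, and $|IK|=\mathcal I_0(K)$. -/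

import Mathlib

open MeasureTheory Filter Topology Set
open scoped ENNReal

noncomputable section

namespace IntersectionBody

/-- Euclidean space `ℝⁿ`. -/
abbrev Rn (n : ℕ) : Type := EuclideanSpace ℝ (Fin n)

/-- The linear hyperplane `θ^⊥` of vectors orthogonal to `θ`. -/
def hyperplane {n : ℕ} (θ : Rn n) : Set (Rn n) := {y | inner ℝ θ y = 0}

/-- `ρ_{I(f)}(θ) = ∫_{θ^⊥} f(y) dy`, where `dy` is the `(n-1)`-dimensional Hausdorff measure
`ℋ^{n-1}` (normalized to agree with Lebesgue measure on `(n-1)`-dimensional Euclidean spaces). -/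
def rho {n : ℕ} (f : Rn n → ℝ) (θ : Rn n) : ℝ :=
  ∫ y in hyperplane θ, f y ∂(Measure.euclideanHausdorffMeasure (n - 1))

/-- The star-shaped set `I(f) = {r θ : θ ∈ 𝕊^{n-1}, 0 ≤ r ≤ ρ_{I(f)}(θ)}`. -/
def I {n : ℕ} (f : Rn n → ℝ) : Set (Rn n) :=
  {x | ∃ θ : Rn n, ‖θ‖ = 1 ∧ ∃ r : ℝ, 0 ≤ r ∧ r ≤ rho f θ ∧ x = r • θ}

/-- The indicator function `1_K`. -/
def ind {n : ℕ} (K : Set (Rn n)) : Rn n → ℝ := K.indicator (fun _ => 1)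

/-- `Δ(x₁,…,x_m)`: the `m`-dimensional volume of the parallelotope
`{∑ tᵢ xᵢ : 0 ≤ tᵢ ≤ 1}`. -/
def Δ {n m : ℕ} (x : Fin m → Rn n) : ℝ≥0∞ :=
  Measure.euclideanHausdorffMeasure m (parallelepiped x)

/-- `(p+1)/n · ∫_{ℝⁿ} ⋯ ∫_{ℝⁿ} Δ(x₁,…,x_n)^p f(x₁) ⋯ f(x_n) dx₁ ⋯ dx_n`
(for `p > -1` and non-negative `f`). -/
def J {n : ℕ} (f : Rn n → ℝ) (p : ℝ) : ℝ≥0∞ :=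
  ENNReal.ofReal ((p + 1) / n) *
    ∫⁻ x : Fin n → Rn n, Δ x ^ p * ∏ i, ENNReal.ofReal (f (x i))

/-- The upper limit of `J f p` as `p → -1⁺`. -/
def upperI0 {n : ℕ} (f : Rn n → ℝ) : ℝ≥0∞ := limsup (J f) (𝓝[>] (-1 : ℝ))

/-- The lower limit of `J f p` as `p → -1⁺`. -/
def lowerI0 {n : ℕ} (f : Rn n → ℝ) : ℝ≥0∞ := liminf (J f) (𝓝[>] (-1 : ℝ))

/-- The rotation invariant probability measure on the unit sphere `𝕊^{n-1}`. -/
def sphereProb (n : ℕ) : Measure (Metric.sphere (0 : Rn n) 1) :=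
  ((volume : Measure (Rn n)).toSphere univ)⁻¹ • (volume : Measure (Rn n)).toSphere

/-- The closed ray `ℝ₊ u`. -/
def ray {n : ℕ} (u : Rn n) : Set (Rn n) := {x | ∃ t : ℝ, 0 ≤ t ∧ x = t • u}

/-- `K` has radially negligible boundary: `∫_{𝕊^{n-1}} |∂K ∩ ℝ₊ u|₁ dσ(u) = 0`. -/
def RadiallyNegligibleBoundary {n : ℕ} (K : Set (Rn n)) : Prop :=
  ∫⁻ u : Metric.sphere (0 : Rn n) 1,
    Measure.euclideanHausdorffMeasure 1 (frontier K ∩ ray (u : Rn n)) ∂(sphereProb n) = 0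

end IntersectionBody

end

/-! Put s = p + 1. For linearly independent x₁,…,x_n, Δ⁻¹ is exactly the volume of the dual body {u
: |⟨u, xᵢ⟩| ≤ 1/2 for all i}. Writing Δ^(s-1) = Δ^s · Δ⁻¹ and applying Tonelli turns the integral
defining `J` into an integral over u of Δ^s ∏ f(xᵢ), taken over tuples in the slab |⟨u, x⟩| ≤ 1/2
(`lintegral_Δ_rpow_eq_slabIntegral`).

The part |u| ≤ 1 is bounded uniformly in s and is killed by the factor s. For u = rθ with r > 1,
rescaling the θ-direction by 1/r gives the slab fixed width; polar coordinates leave the radial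
weight s r^(-1-s), and r = τ^(-1/s) turns it into dτ on (0,1) (`lintegral_slabIntegral_eq`). As s →
0⁺ the compression factor τ^(1/s) tends to 0, so the points collapse onto θ^⊥, while Δ^s → 1 almost
everywhere. The limit is ∫ (∫_{θ^⊥} f)^n dθ, which is n|I(f)| in polar coordinates (`volume_I`).

Passing to the limit needs f to behave well along the collapse. Replacing f by its minimum or
maximum with the limiting value turns semicontinuity into convergence at the price of an inequality,
and dominated convergence applies (`tendsto_lintegral_rescaled`).

For compact K, the upper bound applies to 1_K and the lower bound to the indicator of the interior.
A radially negligible boundary is Lebesgue null, and almost every hyperplane through the origin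
meets a null set in a null set, so K and its interior give the same |I|. -/

noncomputable section

namespace IntersectionBody

/-! ### Polar coordinates and product integrals. -/

section Polar

variable {E : Type*} [NormedAddCommGroup E] [NormedSpace ℝ E] [FiniteDimensional ℝ E]
  [MeasurableSpace E] [BorelSpace E]

lemma lintegral_volumeIoiPow (k : ℕ) (g : ℝ → ℝ≥0∞) (hg : Measurable g) :
    ∫⁻ r : Ioi (0 : ℝ), g r ∂(Measure.volumeIoiPow k) =
      ∫⁻ r in Ioi (0 : ℝ), ENNReal.ofReal (r ^ k) * g r := by
  rw [Measure.volumeIoiPow, lintegral_withDensity_eq_lintegral_mul _ (by fun_prop) (by fun_prop)]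
  exact lintegral_subtype_comap measurableSet_Ioi (fun r : ℝ => ENNReal.ofReal (r ^ k) * g r)

/-- Integration in polar coordinates. -/
lemma lintegral_polar [Nontrivial E] (μ : Measure E) [μ.IsAddHaarMeasure]
    (g : E → ℝ≥0∞) (hg : Measurable g) :
    ∫⁻ x, g x ∂μ = ∫⁻ θ, (∫⁻ r in Ioi (0 : ℝ),
      ENNReal.ofReal (r ^ (Module.finrank ℝ E - 1)) * g (r • (θ : E))) ∂μ.toSphere := by
  calc ∫⁻ x, g x ∂μ = ∫⁻ x in ({0}ᶜ : Set E), g x ∂μ := by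
        rw [restrict_compl_singleton]
    _ = ∫⁻ x : ({0}ᶜ : Set E), g x ∂(μ.comap (↑)) :=
        (lintegral_subtype_comap (measurableSet_singleton _).compl g).symm
    _ = ∫⁻ p, g ((p.2 : ℝ) • (p.1 : E))
          ∂(μ.toSphere.prod (Measure.volumeIoiPow (Module.finrank ℝ E - 1))) := by
        rw [← μ.measurePreserving_homeomorphUnitSphereProd.lintegral_comp (by fun_prop)]
        refine lintegral_congr fun x => ?_
        congr 1
        have hx : ‖(x : E)‖ ≠ 0 := norm_ne_zero_iff.2 x.2
        simp [smul_smul, hx]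
    _ = _ := by
        rw [lintegral_prod _ (by fun_prop)]
        refine lintegral_congr fun θ => ?_
        exact lintegral_volumeIoiPow _ (fun r => g (r • (θ : E))) (by fun_prop)

end Polar

lemma lintegral_fin_pow {α : Type*} [MeasureSpace α] [SigmaFinite (volume : Measure α)]
    (g : α → ℝ≥0∞) (hg : Measurable g) (k : ℕ) :
    ∫⁻ x : Fin k → α, ∏ i, g (x i) = (∫⁻ x, g x) ^ k := by
  induction k with
  | zero => simp [volume_pi]
  | succ k ih =>
    rw [← (volume_preserving_piFinSuccAbove (fun _ : Fin (k + 1) => α) 0).symm.lintegral_comp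
      (by fun_prop)]
    simp only [MeasurableEquiv.piFinSuccAbove_symm_apply, Fin.insertNthEquiv,
      Fin.prod_univ_succ, Fin.insertNth_zero, Equiv.coe_fn_mk, Fin.cons_succ, Fin.cons_zero,
      Fin.zero_succAbove, cast_eq]
    rw [Measure.volume_eq_prod,
      lintegral_prod_mul (g := fun x : Fin k → α => ∏ i, g (x i))
      hg.aemeasurable
      (Finset.measurable_prod _ fun i _ => hg.comp (measurable_pi_apply i)).aemeasurable,
      ih, pow_succ']

/-! ### Coordinates adapted to a direction: head and tail, compression, reflection. -/

section Coordinates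

variable {m : ℕ}

/-- The first standard basis vector of `ℝ^{m+1}`. -/
def firstAxis (m : ℕ) : Rn (m + 1) := EuclideanSpace.single 0 1

/-- All coordinates except the first one. -/
def tail (z : Rn (m + 1)) : Rn m := WithLp.toLp 2 (fun i => z i.succ)

/-- The point with given first coordinate and remaining coordinates. -/
def cons (t : ℝ) (y : Rn m) : Rn (m + 1) := WithLp.toLp 2 (Fin.cons t y)

@[simp] lemma tail_apply (z : Rn (m + 1)) (i : Fin m) : tail z i = z i.succ := rfl

@[simp] lemma cons_zero (t : ℝ) (y : Rn m) : cons t y 0 = t := rfl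

@[simp] lemma cons_succ (t : ℝ) (y : Rn m) (i : Fin m) : cons t y i.succ = y i := rfl

@[simp] lemma tail_cons (t : ℝ) (y : Rn m) : tail (cons t y) = y := rfl

@[simp] lemma cons_tail (z : Rn (m + 1)) : cons (z 0) (tail z) = z := by
  ext i
  refine Fin.cases ?_ (fun i => ?_) i <;> simp

@[simp] lemma firstAxis_zero : firstAxis m 0 = 1 := by simp [firstAxis]

@[simp] lemma firstAxis_succ (i : Fin m) : firstAxis m i.succ = 0 := by simp [firstAxis]

lemma norm_firstAxis : ‖firstAxis m‖ = 1 := by simp [firstAxis]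

lemma inner_firstAxis (z : Rn (m + 1)) : inner ℝ (firstAxis m) z = z 0 := by
  simp [firstAxis, EuclideanSpace.inner_single_left]

lemma norm_sq_eq_head_add_tail (z : Rn (m + 1)) : ‖z‖ ^ 2 = z 0 ^ 2 + ‖tail z‖ ^ 2 := by
  simp [EuclideanSpace.norm_sq_eq, Fin.sum_univ_succ]

@[fun_prop] lemma continuous_tail : Continuous (tail : Rn (m + 1) → Rn m) := by
  unfold tail; fun_prop

@[fun_prop] lemma continuous_cons : Continuous (fun p : ℝ × Rn m => cons p.1 p.2) := by
  unfold cons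
  refine (PiLp.continuous_toLp 2 _).comp (continuous_pi fun i => ?_)
  refine Fin.cases ?_ (fun i => ?_) i
  · simpa using continuous_fst
  · simpa using (by fun_prop : Continuous fun p : ℝ × Rn m => p.2 i)

lemma measurePreserving_head_tail :
    MeasurePreserving (fun z : Rn (m + 1) => (z 0, tail z)) volume volume := by
  have h1 := PiLp.volume_preserving_ofLp (Fin (m + 1))
  have h2 := volume_preserving_piFinSuccAbove (fun _ : Fin (m + 1) => ℝ) 0
  have h3 := PiLp.volume_preserving_toLp (Fin m)
  have h4 := (MeasurePreserving.id (volume : Measure ℝ)).prod h3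
  exact h4.comp (h2.comp h1)

lemma lintegral_head_tail (F : ℝ × Rn m → ℝ≥0∞) (hF : Measurable F) :
    ∫⁻ z : Rn (m + 1), F (z 0, tail z) = ∫⁻ t : ℝ, ∫⁻ y : Rn m, F (t, y) := by
  rw [measurePreserving_head_tail.lintegral_comp hF, Measure.volume_eq_prod,
    lintegral_prod _ hF.aemeasurable]

/-- The isometric embedding of `ℝ^m` as the hyperplane orthogonal to the first axis. -/
def embed (m : ℕ) : Rn m →ₗᵢ[ℝ] Rn (m + 1) where
  toFun := cons 0
  map_add' x y := by
    ext i
    refine Fin.cases ?_ (fun i => ?_) i <;> simp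
  map_smul' c x := by
    ext i
    refine Fin.cases ?_ (fun i => ?_) i <;> simp
  norm_map' x := by
    have := norm_sq_eq_head_add_tail (cons 0 x)
    simpa using this

lemma embed_apply (y : Rn m) : embed m y = cons 0 y := rfl

/-- The linear map multiplying the first coordinate by `c`. -/
def stretch (m : ℕ) (c : ℝ) : Rn (m + 1) →ₗ[ℝ] Rn (m + 1) :=
  LinearMap.transvection (innerₛₗ ℝ (firstAxis m)) ((c - 1) • firstAxis m)

lemma stretch_apply (c : ℝ) (z : Rn (m + 1)) :
    stretch m c z = z + z 0 • (c - 1) • firstAxis m := by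
  simp [stretch, LinearMap.transvection.apply, inner_firstAxis]

lemma stretch_eq_cons (c : ℝ) (z : Rn (m + 1)) : stretch m c z = cons (c * z 0) (tail z) := by
  ext i
  refine Fin.cases ?_ (fun i => ?_) i
  · simp [stretch_apply]; ring
  · simp [stretch_apply]

/-- A transvection z ↦ z + φ(z)v has determinant 1 + φ(v), here 1 + (c - 1). -/
lemma det_stretch (c : ℝ) : LinearMap.det (stretch m c) = c := by
  simp [stretch, LinearMap.transvection.det, norm_firstAxis]

/-- The reflection exchanging the first axis and the unit vector `θ`. -/
def swapAxis (θ : Rn (m + 1)) : Rn (m + 1) ≃ₗᵢ[ℝ] Rn (m + 1) :=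
  (ℝ ∙ (firstAxis m - θ))ᗮ.reflection

lemma swapAxis_firstAxis {θ : Rn (m + 1)} (h : ‖θ‖ = 1) : swapAxis θ (firstAxis m) = θ :=
  Submodule.reflection_sub (by rw [norm_firstAxis, h])

/-- Gives measurability jointly in θ and z. When θ is the first axis the quotient is 0/0 = 0, which
correctly yields the identity. -/
lemma swapAxis_apply (θ z : Rn (m + 1)) :
    swapAxis θ z = z - (2 : ℝ) • (inner ℝ (firstAxis m - θ) z / ‖firstAxis m - θ‖ ^ 2) •
      (firstAxis m - θ) := by
  rw [swapAxis, Submodule.reflection_orthogonal_apply, Submodule.reflection_singleton_apply]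
  simp [two_smul]

lemma measurable_swapAxis :
    Measurable (fun p : Rn (m + 1) × Rn (m + 1) => swapAxis p.1 p.2) := by
  simp only [swapAxis_apply]
  fun_prop

lemma inner_swapAxis {θ : Rn (m + 1)} (h : ‖θ‖ = 1) (z : Rn (m + 1)) :
    inner ℝ θ (swapAxis θ z) = z 0 := by
  rw [← inner_firstAxis, ← (swapAxis θ).inner_map_map (firstAxis m) z, swapAxis_firstAxis h]

end Coordinates

/-! ### Hyperplane sections and the volume of I(f). -/

section Sections

variable {m : ℕ}

lemma hyperplane_eq_range {θ : Rn (m + 1)} (h : ‖θ‖ = 1) :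
    hyperplane θ = range (fun y => swapAxis θ (embed m y)) := by
  ext x
  constructor
  · intro hx
    obtain ⟨z, rfl⟩ := (swapAxis θ).surjective x
    have hz : z 0 = 0 := by rw [← inner_swapAxis h]; exact hx
    refine ⟨tail z, ?_⟩
    have := cons_tail z
    rw [hz] at this
    simp only [embed_apply, this]
  · rintro ⟨y, rfl⟩
    change inner ℝ θ _ = 0
    rw [inner_swapAxis h, embed_apply, cons_zero]

/-- An isometry carries Hausdorff measure to Hausdorff measure on its range, so section integrals
become Lebesgue integrals over a fixed space, with θ as a parameter. -/
lemma restrict_hyperplane {θ : Rn (m + 1)} (h : ‖θ‖ = 1) :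
    (Measure.euclideanHausdorffMeasure m).restrict (hyperplane θ) =
      (volume : Measure (Rn m)).map (fun y => swapAxis θ (embed m y)) := by
  have hi : Isometry (fun y => swapAxis θ (embed m y)) :=
    (swapAxis θ).isometry.comp (embed m).isometry
  rw [hyperplane_eq_range h, ← hi.map_euclideanHausdorffMeasure,
    EuclideanSpace.euclideanHausdorffMeasure_eq_volume]

/-- The integral of `F` over the hyperplane orthogonal to the unit vector `θ`. -/
def sectionLIntegral (F : Rn (m + 1) → ℝ≥0∞) (θ : Rn (m + 1)) : ℝ≥0∞ :=
  ∫⁻ y : Rn m, F (swapAxis θ (embed m y))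

lemma measurable_sectionMap :
    Measurable (fun p : Rn (m + 1) × Rn m => swapAxis p.1 (embed m p.2)) := by
  have h : Measurable (fun p : Rn (m + 1) × Rn m => (p.1, embed m p.2)) :=
    measurable_fst.prodMk ((embed m).continuous.measurable.comp measurable_snd)
  have h' := measurable_swapAxis.comp h
  exact h'

lemma measurable_sectionMap_right (θ : Rn (m + 1)) :
    Measurable (fun y : Rn m => swapAxis θ (embed m y)) :=
  ((swapAxis θ).continuous.comp (embed m).continuous).measurable

lemma measurable_sectionLIntegral {F : Rn (m + 1) → ℝ≥0∞} (hF : Measurable F) :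
    Measurable (sectionLIntegral F) :=
  Measurable.lintegral_prod_right' (f := fun p => F (swapAxis p.1 (embed m p.2)))
    (hF.comp measurable_sectionMap)

lemma rho_eq_toReal {f : Rn (m + 1) → ℝ} (hf : Measurable f) (h0 : ∀ x, 0 ≤ f x)
    {θ : Rn (m + 1)} (h : ‖θ‖ = 1) :
    rho f θ = (sectionLIntegral (fun x => ENNReal.ofReal (f x)) θ).toReal := by
  have hm := measurable_sectionMap_right θ
  rw [rho, Nat.add_sub_cancel, restrict_hyperplane h,
    integral_map hm.aemeasurable hf.aestronglyMeasurable,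
    integral_eq_lintegral_of_nonneg_ae (Eventually.of_forall fun y => h0 _)
      (hf.comp hm).aestronglyMeasurable]
  rfl

lemma sectionLIntegral_le {F : Rn (m + 1) → ℝ≥0∞} {M : ℝ≥0∞} {R : ℝ} (hM : ∀ x, F x ≤ M)
    (hR : ∀ x, F x ≠ 0 → ‖x‖ ≤ R) (θ : Rn (m + 1)) :
    sectionLIntegral F θ ≤ M * volume (Metric.closedBall (0 : Rn m) R) := by
  rw [← setLIntegral_const, sectionLIntegral]
  rw [← lintegral_indicator measurableSet_closedBall]
  refine lintegral_mono fun y => ?_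
  by_cases hy : F (swapAxis θ (embed m y)) = 0
  · simp [hy]
  · have := hR _ hy
    rw [LinearIsometryEquiv.norm_map, LinearIsometry.norm_map] at this
    rw [indicator_of_mem (by simpa using this)]
    exact hM _

lemma smul_mem_I_iff {f : Rn (m + 1) → ℝ} {θ : Rn (m + 1)} (h : ‖θ‖ = 1) {r : ℝ} (hr : 0 < r) :
    r • θ ∈ I f ↔ r ≤ rho f θ := by
  constructor
  · rintro ⟨θ', h', r', hr', hle, heq⟩
    have hn := congrArg norm heq
    rw [norm_smul, norm_smul, h, h', mul_one, mul_one, Real.norm_of_nonneg hr.le,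
      Real.norm_of_nonneg hr'] at hn
    subst hn
    rwa [smul_right_injective _ hr.ne' heq]
  · exact fun hle => ⟨θ, h, r, hr.le, hle, rfl⟩

lemma setLIntegral_Ioc_pow (k : ℕ) {ρ : ℝ} (h : 0 ≤ ρ) :
    ∫⁻ r in Ioc 0 ρ, ENNReal.ofReal (r ^ k) = ENNReal.ofReal (ρ ^ (k + 1) / (k + 1)) := by
  rw [← ofReal_integral_eq_lintegral_ofReal
    (intervalIntegral.intervalIntegrable_pow (a := 0) (b := ρ) (μ := volume) k).1]
  · rw [← intervalIntegral.integral_of_le h]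
    simp
  · filter_upwards [ae_restrict_mem measurableSet_Ioc] with y hy
    exact pow_nonneg hy.1.le _

/-- The volume of `I f` in polar coordinates. -/
lemma volume_I {f : Rn (m + 1) → ℝ} (hf : Measurable f) (h0 : ∀ x, 0 ≤ f x)
    (hfin : ∀ θ, sectionLIntegral (fun x => ENNReal.ofReal (f x)) θ ≠ ∞) :
    volume (I f) = ((m + 1 : ℕ) : ℝ≥0∞)⁻¹ *
      ∫⁻ θ, sectionLIntegral (fun x => ENNReal.ofReal (f x)) (θ : Rn (m + 1)) ^ (m + 1)
        ∂(volume : Measure (Rn (m + 1))).toSphere := by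
  set S := sectionLIntegral (fun x => ENNReal.ofReal (f x)) with hS
  have hSm : Measurable S := measurable_sectionLIntegral (by fun_prop)
  -- A visibly measurable stand-in for `I f`: the two sets agree away from the origin.
  set A : Set (Rn (m + 1)) := {x | ‖x‖ ≤ (S (‖x‖⁻¹ • x)).toReal} with hA
  have hAm : MeasurableSet A := measurableSet_le (by fun_prop) (by fun_prop)
  have key : ∀ θ : Rn (m + 1), ‖θ‖ = 1 → ∀ r : ℝ, 0 < r → (r • θ ∈ A ↔ r ≤ (S θ).toReal) := by
    intro θ hθ r hr
    simp [hA, norm_smul, hθ, abs_of_pos hr, smul_smul, hr.ne']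
  have hIA : I f =ᵐ[volume] A := by
    have : ∀ᵐ x : Rn (m + 1), x ≠ 0 := by simp [ae_iff]
    filter_upwards [this] with x hx
    have hx' : 0 < ‖x‖ := norm_pos_iff.2 hx
    have hu : ‖‖x‖⁻¹ • x‖ = 1 := by simp [norm_smul, hx'.ne']
    have hxx : x = ‖x‖ • (‖x‖⁻¹ • x) := by simp [smul_smul, hx'.ne']
    refine propext ?_
    change x ∈ I f ↔ x ∈ A
    rw [hxx, smul_mem_I_iff hu hx', key _ hu _ hx', rho_eq_toReal hf h0 hu]
  rw [measure_congr hIA, ← lintegral_indicator_one hAm,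
    lintegral_polar volume _ (measurable_one.indicator hAm), ← lintegral_const_mul _ (by fun_prop)]
  refine lintegral_congr fun θ => ?_
  have hθ : ‖(θ : Rn (m + 1))‖ = 1 := by simp
  have h1 : ∀ r ∈ Ioi (0 : ℝ),
      ENNReal.ofReal (r ^ (Module.finrank ℝ (Rn (m + 1)) - 1)) *
        A.indicator 1 (r • (θ : Rn (m + 1))) =
      (Ioc 0 (S θ).toReal).indicator (fun r => ENNReal.ofReal (r ^ m)) r := by
    intro r hr
    by_cases h : r ≤ (S θ).toReal
    · rw [indicator_of_mem ((key _ hθ _ hr).2 h), indicator_of_mem (s := Ioc 0 (S θ).toReal) ⟨hr, h⟩]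
      simp
    · rw [indicator_of_notMem (fun h' => h ((key _ hθ _ hr).1 h')),
        indicator_of_notMem (fun h' => h h'.2), mul_zero]
  rw [setLIntegral_congr_fun measurableSet_Ioi h1, lintegral_indicator measurableSet_Ioc,
    Measure.restrict_restrict measurableSet_Ioc,
    inter_eq_left.2 (Ioc_subset_Ioi_self : Ioc 0 (S θ).toReal ⊆ Ioi 0),
    setLIntegral_Ioc_pow _ ENNReal.toReal_nonneg, div_eq_inv_mul,
    ENNReal.ofReal_mul (by positivity), ENNReal.ofReal_pow ENNReal.toReal_nonneg,
    ENNReal.ofReal_toReal (hfin _), ENNReal.ofReal_inv_of_pos (by positivity)]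
  congr 2
  rw [← ENNReal.ofReal_natCast]
  simp

end Sections

/-! ### The parallelotope volume and its dual body. -/

section Volume

variable {n : ℕ}

lemma Δ_eq_det (x : Fin n → Rn n) :
    Δ x = ENNReal.ofReal |(EuclideanSpace.basisFun (Fin n) ℝ).toBasis.det x| := by
  rw [Δ, EuclideanSpace.euclideanHausdorffMeasure_eq_volume, ← Measure.addHaar_parallelepiped,
    (EuclideanSpace.basisFun (Fin n) ℝ).addHaar_eq_volume]

lemma Δ_ne_top (x : Fin n → Rn n) : Δ x ≠ ∞ := by simp [Δ_eq_det]

lemma det_basisFun_eq (x : Fin n → Rn n) :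
    (EuclideanSpace.basisFun (Fin n) ℝ).toBasis.det x = (Matrix.of fun i j => x i j).det := by
  rw [Module.Basis.det_apply, ← Matrix.det_transpose]
  congr 1

lemma continuous_det_basisFun :
    Continuous fun x : Fin n → Rn n => (EuclideanSpace.basisFun (Fin n) ℝ).toBasis.det x := by
  simp only [det_basisFun_eq]
  fun_prop

@[fun_prop] lemma continuous_Δ : Continuous (Δ : (Fin n → Rn n) → ℝ≥0∞) := by
  have : (Δ : (Fin n → Rn n) → ℝ≥0∞) = fun x =>
    ENNReal.ofReal |(EuclideanSpace.basisFun (Fin n) ℝ).toBasis.det x| := funext Δ_eq_det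
  rw [this]
  exact ENNReal.continuous_ofReal.comp continuous_det_basisFun.abs

lemma Δ_map (L : Rn n →ₗ[ℝ] Rn n) (x : Fin n → Rn n) :
    Δ (fun i => L (x i)) = ENNReal.ofReal |LinearMap.det L| * Δ x := by
  rw [Δ_eq_det, Δ_eq_det, ← ENNReal.ofReal_mul (abs_nonneg _), ← abs_mul, ← Module.Basis.det_comp]
  rfl

/-- The vectors spanning a degenerate parallelotope form a null set. -/
lemma ae_Δ_ne_zero : ∀ᵐ x : Fin n → Rn n, Δ x ≠ 0 := by
  have hm : MeasurableSet {x : Fin n → Rn n | Δ x ≠ 0} :=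
    (continuous_Δ.measurable (measurableSet_singleton 0)).compl
  -- Along the line y + t · identity the determinant is the characteristic polynomial of -y at t:
  -- monic, so with finitely many roots. Null intersection with every such line suffices.
  let v : Fin n → Rn n := fun i => EuclideanSpace.single i 1
  refine ae_mem_of_ae_add_linearMap_mem (LinearMap.toSpanSingleton ℝ (Fin n → Rn n) v)
    (volume : Measure ℝ) volume hm fun y => ?_
  have hchar : ∀ t : ℝ, (Matrix.of fun i j => (y + t • v) i j).det =
      (-(Matrix.of fun i j => y i j)).charpoly.eval t := by
    intro t
    rw [Matrix.eval_charpoly]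
    congr 1
    ext i j
    simp [v, add_comm, Matrix.scalar_apply, Matrix.diagonal_apply, eq_comm]
  have hfin : {t : ℝ | (-(Matrix.of fun i j => y i j)).charpoly.IsRoot t}.Finite :=
    Polynomial.finite_setOfPred_isRoot (Matrix.charpoly_monic _).ne_zero
  have := hfin.countable.ae_notMem volume
  filter_upwards [this] with t ht
  change Δ (y + t • v) ≠ 0
  rw [Δ_eq_det, det_basisFun_eq, hchar, ne_eq, ENNReal.ofReal_eq_zero, abs_nonpos_iff]
  exact ht

/-- The set of `u` whose inner products with the vectors `x i` are at most `1 / 2` in absolute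
value has volume `(Δ x)⁻¹`. -/
lemma volume_dual_parallelepiped {x : Fin n → Rn n} (hx : Δ x ≠ 0) :
    volume {u : Rn n | ∀ i, |inner ℝ u (x i)| ≤ 1 / 2} = (Δ x)⁻¹ := by
  set A : Matrix (Fin n) (Fin n) ℝ := Matrix.of fun i j => x i j with hA
  have hdet : A.det ≠ 0 := by
    rw [Δ_eq_det, det_basisFun_eq] at hx
    simpa using hx
  -- The preimage of a cube under the matrix with rows xᵢ. Half-width 1/2 gives the cube volume one,
  -- so no constant appears.
  have hset : {u : Rn n | ∀ i, |inner ℝ u (x i)| ≤ 1 / 2} =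
      WithLp.ofLp ⁻¹' (A.toLin' ⁻¹' (univ.pi fun _ => Icc (-(1 / 2)) (1 / 2))) := by
    ext u
    simp only [mem_ofPred_eq, mem_preimage, mem_univ_pi, mem_Icc, ← abs_le]
    refine forall_congr' fun i => ?_
    have : inner ℝ u (x i) = (A.toLin' u.ofLp) i := by
      simp [hA, Matrix.mulVec, dotProduct, PiLp.inner_apply]
    rw [this]
  rw [hset, (PiLp.volume_preserving_ofLp (Fin n)).measure_preimage
      (measurableSet_preimage A.toLin'.continuous_of_finiteDimensional.measurable
        (MeasurableSet.univ_pi fun _ => measurableSet_Icc)).nullMeasurableSet,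
    Measure.addHaar_preimage_linearMap _ (by simpa using hdet)]
  rw [volume_pi_pi, LinearMap.det_toLin', Δ_eq_det, det_basisFun_eq, ← hA, abs_inv,
    ENNReal.ofReal_inv_of_pos (abs_pos.2 hdet)]
  simp
  norm_num

end Volume

/-! ### The integral representation by slabs and its rescaling. -/

section Representation

variable {m : ℕ}

/-- Acting by L on each of n vectors is block diagonal, with determinant (det L)^n. -/
lemma lintegral_comp_linearMap_pi {n : ℕ} {L : Rn n →ₗ[ℝ] Rn n} (hL : LinearMap.det L ≠ 0)
    {G : (Fin n → Rn n) → ℝ≥0∞} (hG : Measurable G) :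
    ENNReal.ofReal |LinearMap.det L| ^ n * ∫⁻ z : Fin n → Rn n, G (fun i => L (z i)) = ∫⁻ x, G x := by
  set Lp : (Fin n → Rn n) →ₗ[ℝ] (Fin n → Rn n) := LinearMap.pi fun i => L ∘ₗ LinearMap.proj i
  have hdet : LinearMap.det Lp = LinearMap.det L ^ n := by simp [Lp, LinearMap.det_pi]
  have hdet0 : LinearMap.det Lp ≠ 0 := by rw [hdet]; exact pow_ne_zero _ hL
  have h1 : ∫⁻ z : Fin n → Rn n, G (fun i => L (z i)) =
      ∫⁻ x, G x ∂((volume : Measure (Fin n → Rn n)).map Lp) :=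
    (lintegral_map hG Lp.continuous_of_finiteDimensional.measurable).symm
  rw [h1, Measure.map_linearMap_addHaar_eq_smul_addHaar _ hdet0, lintegral_smul_measure,
    smul_eq_mul, ← mul_assoc, ← ENNReal.ofReal_pow (abs_nonneg _), ← abs_pow, ← hdet,
    ← ENNReal.ofReal_mul (abs_nonneg _), abs_inv, mul_inv_cancel₀ (abs_ne_zero.2 hdet0)]
  simp

lemma abs_det_swapAxis (θ : Rn (m + 1)) :
    |LinearMap.det ((swapAxis θ).toLinearEquiv : Rn (m + 1) →ₗ[ℝ] Rn (m + 1))| = 1 := by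
  rw [swapAxis]
  have := Submodule.det_reflection (𝕜 := ℝ) (ℝ ∙ (firstAxis m - θ))ᗮ
  change |LinearMap.det (Submodule.reflection (ℝ ∙ (firstAxis m - θ))ᗮ).toLinearMap| = 1
  rw [this, abs_pow, abs_neg, abs_one, one_pow]

/-- The indicator of the interval `[-1/2, 1/2]`. -/
def slab : ℝ → ℝ≥0∞ := {t : ℝ | |t| ≤ 1 / 2}.indicator 1

@[fun_prop] lemma measurable_slab : Measurable slab :=
  measurable_one.indicator (measurableSet_le (by fun_prop) (by fun_prop))

lemma slab_le_one (t : ℝ) : slab t ≤ 1 := indicator_le_self' (by simp) t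

lemma prod_slab {n : ℕ} (t : Fin n → ℝ) :
    ∏ i, slab (t i) = {t : Fin n → ℝ | ∀ i, |t i| ≤ 1 / 2}.indicator 1 t := by
  by_cases h : ∀ i, |t i| ≤ 1 / 2
  · rw [indicator_of_mem (by exact h)]
    exact Finset.prod_eq_one fun i _ => indicator_of_mem (by exact h i) _
  · rw [indicator_of_notMem (by exact h)]
    obtain ⟨i, hi⟩ := not_forall.1 h
    exact Finset.prod_eq_zero (Finset.mem_univ i) (indicator_of_notMem (by exact hi) _)

/-- The integral of `Δ^s ∏ F(x_i)` over tuples of vectors in the slab `|⟨u, x⟩| ≤ 1/2`. -/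
def slabIntegral {n : ℕ} (F : Rn n → ℝ≥0∞) (s : ℝ) (u : Rn n) : ℝ≥0∞ :=
  ∫⁻ x : Fin n → Rn n, Δ x ^ s * ∏ i, F (x i) * slab (inner ℝ u (x i))

lemma measurable_prod_apply {α β : Type*} [MeasurableSpace α] [MeasurableSpace β] {n : ℕ}
    {F : α → ℝ≥0∞} (hF : Measurable F) {g : β → Fin n → α} (hg : ∀ i, Measurable fun b => g b i) :
    Measurable fun b => ∏ i, F (g b i) :=
  Finset.measurable_prod _ fun i _ => hF.comp (hg i)

lemma measurable_slabIntegrand {n : ℕ} {F : Rn n → ℝ≥0∞} (hF : Measurable F) (s : ℝ) :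
    Measurable fun p : Rn n × (Fin n → Rn n) =>
      Δ p.2 ^ s * ∏ i, F (p.2 i) * slab (inner ℝ p.1 (p.2 i)) := by
  have h1 : Measurable fun p : Rn n × (Fin n → Rn n) => Δ p.2 ^ s :=
    (continuous_Δ.measurable.comp measurable_snd).pow_const s
  refine h1.mul (Finset.measurable_prod _ fun i _ => ?_)
  have h2 : Measurable fun p : Rn n × (Fin n → Rn n) => p.2 i := by fun_prop
  exact (hF.comp h2).mul (measurable_slab.comp (by fun_prop))

lemma measurable_slabIntegral {n : ℕ} {F : Rn n → ℝ≥0∞} (hF : Measurable F) (s : ℝ) :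
    Measurable (slabIntegral F s) :=
  (measurable_slabIntegrand hF s).lintegral_prod_right'

/-- Off the null set of degenerate tuples, the missing factor Δ⁻¹ is the volume of the dual body;
Tonelli then moves the integral over u outside. -/
lemma lintegral_Δ_rpow_eq_slabIntegral {n : ℕ} {F : Rn n → ℝ≥0∞} (hF : Measurable F) (s : ℝ) :
    ∫⁻ x : Fin n → Rn n, Δ x ^ (s - 1) * ∏ i, F (x i) = ∫⁻ u, slabIntegral F s u := by
  unfold slabIntegral
  rw [lintegral_lintegral_swap (measurable_slabIntegrand hF s).aemeasurable]
  refine lintegral_congr_ae ?_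
  filter_upwards [ae_Δ_ne_zero] with x hx
  have hm : MeasurableSet {u : Rn n | ∀ i, |inner ℝ u (x i)| ≤ 1 / 2} := by
    simp only [Set.ofPred_forall]
    exact MeasurableSet.iInter fun i => measurableSet_le (by fun_prop) (by fun_prop)
  simp_rw [Finset.prod_mul_distrib, prod_slab, ← mul_assoc]
  have : ∀ u : Rn n, {t : Fin n → ℝ | ∀ i, |t i| ≤ 1 / 2}.indicator (1 : (Fin n → ℝ) → ℝ≥0∞)
      (fun i => inner ℝ u (x i)) = {u : Rn n | ∀ i, |inner ℝ u (x i)| ≤ 1 / 2}.indicator 1 u :=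
    fun u => rfl
  simp_rw [this]
  rw [lintegral_const_mul _ (measurable_one.indicator hm), lintegral_indicator_one hm,
    volume_dual_parallelepiped hx, ENNReal.rpow_sub _ _ hx (Δ_ne_top x), ENNReal.rpow_one,
    div_eq_mul_inv, mul_right_comm]

/-- The integrand of the rescaled slab integral. -/
def rescaledIntegrand (F : Rn (m + 1) → ℝ≥0∞) (s : ℝ) (θ : Rn (m + 1)) (c : ℝ)
    (z : Fin (m + 1) → Rn (m + 1)) : ℝ≥0∞ :=
  Δ z ^ s * ∏ i, F (swapAxis θ (stretch m c (z i))) * slab (z i 0)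

/-- Substitute xᵢ = reflection of the compressed zᵢ, so that ⟨rθ, xᵢ⟩ is the first coordinate of zᵢ.
The Jacobian on m + 1 vectors is r^-(m+1), and Δ^s contributes r^(-s). -/
lemma slabIntegral_smul {F : Rn (m + 1) → ℝ≥0∞} (hF : Measurable F) {s : ℝ} (hs : 0 ≤ s)
    {θ : Rn (m + 1)} (hθ : ‖θ‖ = 1) {r : ℝ} (hr : 0 < r) :
    slabIntegral F s (r • θ) = ENNReal.ofReal (r⁻¹ ^ (m + 1) * r⁻¹ ^ s) *
      ∫⁻ z, rescaledIntegrand F s θ r⁻¹ z := by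
  set L : Rn (m + 1) →ₗ[ℝ] Rn (m + 1) := (swapAxis θ).toLinearEquiv ∘ₗ stretch m r⁻¹ with hL
  have hLa : ∀ z, L z = swapAxis θ (stretch m r⁻¹ z) := fun z => rfl
  have hr' : 0 < r⁻¹ := inv_pos.2 hr
  have hdet : |LinearMap.det L| = r⁻¹ := by
    rw [hL, LinearMap.det_comp, abs_mul, abs_det_swapAxis, det_stretch, one_mul, abs_of_pos hr']
  have hdet0 : LinearMap.det L ≠ 0 := abs_pos.1 (by rw [hdet]; exact hr')
  have hG : Measurable fun x : Fin (m + 1) → Rn (m + 1) =>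
      Δ x ^ s * ∏ i, F (x i) * slab (inner ℝ (r • θ) (x i)) := by
    have h := (measurable_slabIntegrand hF s).comp (measurable_prodMk_left (x := r • θ))
    exact h
  rw [slabIntegral, ← lintegral_comp_linearMap_pi hdet0 hG, hdet,
    ENNReal.ofReal_mul (by positivity), ENNReal.ofReal_pow hr'.le, mul_assoc,
    ← lintegral_const_mul' _ _ ENNReal.ofReal_ne_top]
  congr 1
  refine lintegral_congr fun z => ?_
  rw [rescaledIntegrand, Δ_map, hdet, ENNReal.mul_rpow_of_nonneg _ _ hs,
    ENNReal.ofReal_rpow_of_pos hr', mul_assoc]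
  congr 2
  refine Finset.prod_congr rfl fun i _ => ?_
  beta_reduce
  rw [hLa, real_inner_smul_left, inner_swapAxis hθ, stretch_eq_cons, cons_zero, ← mul_assoc,
    mul_inv_cancel₀ hr.ne', one_mul]

lemma measurable_rescaledArgument :
    Measurable fun p : Rn (m + 1) × ℝ × Rn (m + 1) => swapAxis p.1 (stretch m p.2.1 p.2.2) := by
  have h : Measurable fun p : Rn (m + 1) × ℝ × Rn (m + 1) => (p.1, stretch m p.2.1 p.2.2) := by
    simp only [stretch_apply]
    fun_prop
  have h' := measurable_swapAxis.comp h
  exact h'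

/-- The substitution `r = τ^(-1/s)`. -/
lemma lintegral_Ioi_one_rpow (g : ℝ → ℝ≥0∞) {s : ℝ} (hs : 0 < s) :
    ENNReal.ofReal s * ∫⁻ r in Ioi (1 : ℝ), ENNReal.ofReal (r⁻¹ ^ (1 + s)) * g r⁻¹ =
      ∫⁻ τ in Ioo (0 : ℝ) 1, g (τ ^ (1 / s)) := by
  have himg : (fun τ : ℝ => τ ^ (-(1 / s))) '' Ioo 0 1 = Ioi 1 := by
    ext r
    constructor
    · rintro ⟨τ, ⟨h0, h1⟩, rfl⟩
      exact Real.one_lt_rpow_of_pos_of_lt_one_of_neg h0 h1 (by simpa using hs)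
    · intro hr
      have hr0 : 0 < r := zero_lt_one.trans hr
      refine ⟨r ^ (-s), ⟨by positivity, Real.rpow_lt_one_of_one_lt_of_neg hr (by simpa using hs)⟩,
        ?_⟩
      simp only
      rw [← Real.rpow_mul hr0.le, neg_mul_neg, mul_one_div_cancel hs.ne', Real.rpow_one]
  have hinj : InjOn (fun τ : ℝ => τ ^ (-(1 / s))) (Ioo 0 1) := fun a ha b hb h =>
    Real.rpow_left_injOn (by simpa using hs.ne') ha.1.le hb.1.le h
  rw [← himg, lintegral_image_eq_lintegral_abs_deriv_mul measurableSet_Ioo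
    (fun τ hτ => (Real.hasDerivAt_rpow_const (Or.inl hτ.1.ne')).hasDerivWithinAt) hinj,
    ← lintegral_const_mul' _ _ ENNReal.ofReal_ne_top]
  refine setLIntegral_congr_fun measurableSet_Ioo fun τ hτ => ?_
  have hτ0 : 0 < τ := hτ.1
  rw [← Real.rpow_neg hτ0.le, neg_neg, ← mul_assoc, ← mul_assoc, ← ENNReal.ofReal_mul hs.le,
    ← ENNReal.ofReal_mul (by positivity), abs_mul, abs_neg, abs_of_pos (by positivity : 0 < 1 / s),
    abs_of_pos (by positivity), ← Real.rpow_mul hτ0.le]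
  have : s * (1 / s * τ ^ (-(1 / s) - 1)) * τ ^ (1 / s * (1 + s)) = 1 := by
    rw [← mul_assoc, mul_one_div_cancel hs.ne', one_mul, ← Real.rpow_add hτ0]
    have : -(1 / s) - 1 + 1 / s * (1 + s) = 0 := by field_simp; ring
    rw [this, Real.rpow_zero]
  rw [this, ENNReal.ofReal_one, one_mul]

/-- Outside the unit ball the polar density r^m meets r^-(m+1) r^(-s), leaving r^(-1-s); the change
of variable to τ absorbs the factor s. The unit ball is split off because r^(-1-s) is not integrable
at 0. -/
lemma lintegral_slabIntegral_eq {F : Rn (m + 1) → ℝ≥0∞} (hF : Measurable F) {s : ℝ} (hs : 0 < s) :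
    ENNReal.ofReal s * ∫⁻ u, slabIntegral F s u =
      ENNReal.ofReal s * (∫⁻ u in Metric.closedBall 0 1, slabIntegral F s u) +
      ∫⁻ θ, (∫⁻ τ in Ioo (0 : ℝ) 1, ∫⁻ z, rescaledIntegrand F s (θ : Rn (m + 1)) (τ ^ (1 / s)) z)
        ∂(volume : Measure (Rn (m + 1))).toSphere := by
  rw [← lintegral_add_compl _ (measurableSet_closedBall (x := (0 : Rn (m + 1))) (ε := 1)), mul_add]
  congr 1
  have hmc : MeasurableSet (Metric.closedBall (0 : Rn (m + 1)) 1)ᶜ := measurableSet_closedBall.compl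
  rw [← lintegral_indicator hmc,
    lintegral_polar volume _ ((measurable_slabIntegral hF s).indicator hmc),
    ← lintegral_const_mul' _ _ ENNReal.ofReal_ne_top]
  refine lintegral_congr fun θ => ?_
  have hθ : ‖(θ : Rn (m + 1))‖ = 1 := by simp
  rw [← lintegral_Ioi_one_rpow (fun c => ∫⁻ z, rescaledIntegrand F s (θ : Rn (m + 1)) c z) hs]
  congr 1
  have h1 : ∀ r ∈ Ioi (0 : ℝ),
      ENNReal.ofReal (r ^ (Module.finrank ℝ (Rn (m + 1)) - 1)) *
        (Metric.closedBall (0 : Rn (m + 1)) 1)ᶜ.indicator (slabIntegral F s)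
          (r • (θ : Rn (m + 1))) =
      (Ioi (1 : ℝ)).indicator (fun r => ENNReal.ofReal (r⁻¹ ^ (1 + s)) *
        ∫⁻ z, rescaledIntegrand F s (θ : Rn (m + 1)) r⁻¹ z) r := by
    intro r hr
    have hr0 : 0 < r := hr
    have hmem : r • (θ : Rn (m + 1)) ∈ (Metric.closedBall (0 : Rn (m + 1)) 1)ᶜ ↔ r ∈ Ioi (1 : ℝ) := by
      simp [norm_smul, hθ, abs_of_pos hr0]
    by_cases h : r ∈ Ioi (1 : ℝ)
    · rw [indicator_of_mem (hmem.2 h), indicator_of_mem h, slabIntegral_smul hF hs.le hθ hr0,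
        ← mul_assoc, ← ENNReal.ofReal_mul (by positivity)]
      congr 2
      have hr1 : 0 < r⁻¹ := inv_pos.2 hr0
      rw [Real.rpow_add hr1, Real.rpow_one, finrank_euclideanSpace_fin, Nat.add_sub_cancel,
        ← mul_assoc, pow_succ, ← mul_assoc, ← mul_pow, mul_inv_cancel₀ hr0.ne', one_pow, one_mul]
    · rw [indicator_of_notMem (fun h' => h (hmem.1 h')), indicator_of_notMem h, mul_zero]
  rw [setLIntegral_congr_fun measurableSet_Ioi h1, lintegral_indicator measurableSet_Ioi,
    Measure.restrict_restrict measurableSet_Ioi,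
    inter_eq_left.2 (Ioi_subset_Ioi zero_le_one : Ioi (1 : ℝ) ⊆ Ioi 0)]

end Representation

/-! ### Dominated convergence as s tends to 0. -/

section Limit

variable {m : ℕ}

/-- Compactness and continuity. Requiring C ≥ 1 makes C bound Δ^s for all s in [0,1] at once. -/
lemma exists_Δ_le (n : ℕ) (R : ℝ) : ∃ C : ℝ≥0∞, 1 ≤ C ∧ C ≠ ∞ ∧
    ∀ x : Fin n → Rn n, (∀ i, ‖x i‖ ≤ R) → Δ x ≤ C := by
  have hK : IsCompact (univ.pi fun _ : Fin n => Metric.closedBall (0 : Rn n) R) :=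
    isCompact_univ_pi fun _ => isCompact_closedBall _ _
  rcases (univ.pi fun _ : Fin n => Metric.closedBall (0 : Rn n) R).eq_empty_or_nonempty with h | h
  · refine ⟨1, le_rfl, by simp, fun x hx => ?_⟩
    have : x ∈ univ.pi fun _ : Fin n => Metric.closedBall (0 : Rn n) R := fun i _ => by
      simpa using hx i
    rw [h] at this
    exact absurd this (notMem_empty x)
  · obtain ⟨y, -, hy⟩ := hK.exists_isMaxOn h continuous_Δ.continuousOn
    refine ⟨max 1 (Δ y), le_max_left _ _, by simp [Δ_ne_top], fun x hx => ?_⟩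
    exact (hy (show x ∈ _ from fun i _ => by simpa using hx i)).trans (le_max_right _ _)

lemma rpow_le_of_le_one {a C : ℝ≥0∞} {s : ℝ} (ha : a ≤ C) (hC : 1 ≤ C) (h0 : 0 ≤ s) (h1 : s ≤ 1) :
    a ^ s ≤ C :=
  (ENNReal.rpow_le_rpow ha h0).trans <| by
    simpa using ENNReal.rpow_le_rpow_of_exponent_le hC h1

/-- The value a = 0 must be excluded, since 0^s = 0 for s > 0; hence degenerate tuples have to be
null. -/
lemma tendsto_const_rpow_zero {a : ℝ≥0∞} (h0 : a ≠ 0) (ht : a ≠ ∞) :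
    Tendsto (fun s : ℝ => a ^ s) (𝓝 0) (𝓝 1) := by
  have hpos : 0 < a.toReal := ENNReal.toReal_pos h0 ht
  have h : Tendsto (fun s : ℝ => ENNReal.ofReal (a.toReal ^ s)) (𝓝 0) (𝓝 1) := by
    have := ENNReal.tendsto_ofReal ((Real.continuous_const_rpow hpos.ne').tendsto 0)
    simpa using this
  refine h.congr fun s => ?_
  rw [← ENNReal.ofReal_rpow_of_pos hpos, ENNReal.ofReal_toReal ht]

/-- Integrals of `Δ^s ∏ G(x_i)` are bounded if `G` is bounded with bounded support. -/
lemma Δ_rpow_mul_prod_le {n : ℕ} {C M : ℝ≥0∞} {R : ℝ} (hC1 : 1 ≤ C)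
    (hC : ∀ x : Fin n → Rn n, (∀ i, ‖x i‖ ≤ R) → Δ x ≤ C) {s : ℝ} (hs0 : 0 ≤ s) (hs1 : s ≤ 1)
    (x : Fin n → Rn n) {a : Fin n → ℝ≥0∞} (ha : ∀ i, a i ≤ M) (hR : ∀ i, a i ≠ 0 → ‖x i‖ ≤ R) :
    Δ x ^ s * ∏ i, a i ≤
      C * ∏ i, (Metric.closedBall (0 : Rn n) R).indicator (fun _ => M) (x i) := by
  by_cases h : ∀ i, a i ≠ 0
  · refine mul_le_mul' (rpow_le_of_le_one (hC x fun i => hR i (h i)) hC1 hs0 hs1)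
      (Finset.prod_le_prod' fun i _ => ?_)
    rw [indicator_of_mem (by simpa using hR i (h i))]
    exact ha i
  · push Not at h
    obtain ⟨i, hi⟩ := h
    rw [Finset.prod_eq_zero (Finset.mem_univ i) hi, mul_zero]
    exact zero_le

lemma lintegral_prod_closedBall {n : ℕ} (C M : ℝ≥0∞) (R : ℝ) :
    ∫⁻ x : Fin n → Rn n, C * ∏ i, (Metric.closedBall (0 : Rn n) R).indicator (fun _ => M) (x i) =
      C * (M * volume (Metric.closedBall (0 : Rn n) R)) ^ n := by
  have hm : Measurable ((Metric.closedBall (0 : Rn n) R).indicator fun _ => M) :=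
    measurable_const.indicator measurableSet_closedBall
  rw [lintegral_const_mul _ (measurable_prod_apply hm fun i => measurable_pi_apply i),
    lintegral_fin_pow _ hm, lintegral_indicator measurableSet_closedBall, setLIntegral_const]

/-- Uniformity in s and u is what makes s times the unit-ball part vanish. -/
lemma exists_slabIntegral_le {n : ℕ} {F : Rn n → ℝ≥0∞} {M : ℝ≥0∞} {R : ℝ} (hMt : M ≠ ∞)
    (hM : ∀ x, F x ≤ M) (hR : ∀ x, F x ≠ 0 → ‖x‖ ≤ R) :
    ∃ B : ℝ≥0∞, B ≠ ∞ ∧ ∀ s, 0 ≤ s → s ≤ 1 → ∀ u, slabIntegral F s u ≤ B := by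
  obtain ⟨C, hC1, hCt, hC⟩ := exists_Δ_le n R
  refine ⟨C * (M * volume (Metric.closedBall (0 : Rn n) R)) ^ n, ?_, fun s h0 h1 u => ?_⟩
  · exact ENNReal.mul_ne_top hCt
      (ENNReal.pow_ne_top (ENNReal.mul_ne_top hMt measure_closedBall_lt_top.ne))
  · rw [← lintegral_prod_closedBall]
    refine lintegral_mono fun x => Δ_rpow_mul_prod_le hC1 hC h0 h1 x (fun i => ?_) fun i hi => ?_
    · exact (mul_le_of_le_one_right' (slab_le_one _)).trans (hM _)
    · exact hR _ (left_ne_zero_of_mul hi)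

/-- After full collapse the integrand factors over i, and each factor is a section integral times
the slab's length, which is 1. -/
lemma lintegral_section_prod {F : Rn (m + 1) → ℝ≥0∞} (hF : Measurable F) (θ : Rn (m + 1)) :
    ∫⁻ z : Fin (m + 1) → Rn (m + 1), ∏ i, F (swapAxis θ (embed m (tail (z i)))) * slab (z i 0) =
      sectionLIntegral F θ ^ (m + 1) := by
  have hFm : Measurable fun y => F (swapAxis θ (embed m y)) := by
    have h := hF.comp (measurable_sectionMap_right θ)
    exact h
  have h1 : Measurable fun p : ℝ × Rn m => F (swapAxis θ (embed m p.2)) * slab p.1 :=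
    (hFm.comp measurable_snd).mul (measurable_slab.comp measurable_fst)
  have h2 : Measurable fun z : Rn (m + 1) => F (swapAxis θ (embed m (tail z))) * slab (z 0) := by
    have h := h1.comp (measurePreserving_head_tail (m := m)).measurable
    exact h
  rw [lintegral_fin_pow _ h2,
    lintegral_head_tail (fun p => F (swapAxis θ (embed m p.2)) * slab p.1) h1]
  congr 1
  have h3 : ∫⁻ t, slab t = 1 := by
    have : {t : ℝ | |t| ≤ 1 / 2} = Icc (-(1 / 2)) (1 / 2) := by ext; simp [abs_le]
    rw [slab, lintegral_indicator_one (measurableSet_le (by fun_prop) (by fun_prop)), this,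
      Real.volume_Icc]
    norm_num
  simp_rw [lintegral_mul_const _ hFm]
  rw [lintegral_const_mul _ measurable_slab, h3, mul_one, sectionLIntegral]

/-- Compression leaves the tail unchanged and the slab bounds the head, so all rescaled integrands
live in one ball, independent of the compression. -/
lemma norm_le_of_norm_tail_le {z : Rn (m + 1)} {R : ℝ} (hR : 0 ≤ R) (h : ‖tail z‖ ≤ R)
    (h0 : |z 0| ≤ 1 / 2) : ‖z‖ ≤ R + 1 := by
  refine abs_le_of_sq_le_sq' ?_ (by positivity) |>.2
  have h1 : z 0 ^ 2 ≤ 1 := by rw [← sq_abs]; nlinarith [abs_nonneg (z 0)]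
  rw [norm_sq_eq_head_add_tail]
  nlinarith [norm_nonneg (tail z)]

lemma norm_tail_le (z : Rn (m + 1)) : ‖tail z‖ ≤ ‖z‖ := by
  refine abs_le_of_sq_le_sq' ?_ (norm_nonneg _) |>.2
  rw [norm_sq_eq_head_add_tail z]
  nlinarith [sq_nonneg (z 0)]

lemma tendsto_stretch (z : Rn (m + 1)) :
    Tendsto (fun c => stretch m c z) (𝓝 0) (𝓝 (embed m (tail z))) := by
  have h : Continuous fun c => stretch m c z := by
    simp only [stretch_apply]
    fun_prop
  have h0 : stretch m 0 z = embed m (tail z) := by rw [stretch_eq_cons, zero_mul, embed_apply]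
  rw [← h0]
  exact h.tendsto 0

/-- Dominated convergence for the rescaled integrals. Here `op` is `max` or `min`, chosen so that
semicontinuity becomes continuity. -/
lemma tendsto_lintegral_rescaled {F : Rn (m + 1) → ℝ≥0∞} (hF : Measurable F) {M : ℝ≥0∞} {R : ℝ}
    (hMt : M ≠ ∞) (hM : ∀ x, F x ≤ M) (hR : ∀ x, F x ≠ 0 → ‖x‖ ≤ R) (hR0 : 0 ≤ R)
    {op : ℝ≥0∞ → ℝ≥0∞ → ℝ≥0∞} (hop : Measurable (Function.uncurry op))
    (hop_le : ∀ a b, op a b ≤ max a b)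
    (hlim : ∀ (θ z : Rn (m + 1)), Tendsto (fun c => op (F (swapAxis θ (stretch m c z)))
      (F (swapAxis θ (embed m (tail z))))) (𝓝 0) (𝓝 (F (swapAxis θ (embed m (tail z)))))) :
    Tendsto (fun s : ℝ => ∫⁻ θ, (∫⁻ τ in Ioo (0 : ℝ) 1, ∫⁻ z : Fin (m + 1) → Rn (m + 1),
      Δ z ^ s * ∏ i, op (F (swapAxis (θ : Rn (m + 1)) (stretch m (τ ^ (1 / s)) (z i))))
        (F (swapAxis (θ : Rn (m + 1)) (embed m (tail (z i))))) * slab (z i 0))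
          ∂(volume : Measure (Rn (m + 1))).toSphere) (𝓝[>] 0)
      (𝓝 (∫⁻ θ, sectionLIntegral F (θ : Rn (m + 1)) ^ (m + 1)
        ∂(volume : Measure (Rn (m + 1))).toSphere)) := by
  obtain ⟨C, hC1, hCt, hC⟩ := exists_Δ_le (m + 1) (R + 1)
  set σ := (volume : Measure (Rn (m + 1))).toSphere
  set ν : Measure ℝ := volume.restrict (Ioo (0 : ℝ) 1) with hν
  set B := Metric.closedBall (0 : Rn (m + 1)) (R + 1) with hB
  -- The iterated integral is treated on a single product space, so that dominated convergence is
  -- applied once.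
  let G : ℝ → (Metric.sphere (0 : Rn (m + 1)) 1 × ℝ × (Fin (m + 1) → Rn (m + 1))) → ℝ≥0∞ :=
    fun s p => Δ p.2.2 ^ s * ∏ i, op (F (swapAxis (p.1 : Rn (m + 1))
      (stretch m (p.2.1 ^ (1 / s)) (p.2.2 i))))
        (F (swapAxis (p.1 : Rn (m + 1)) (embed m (tail (p.2.2 i))))) * slab (p.2.2 i 0)
  let G0 : (Metric.sphere (0 : Rn (m + 1)) 1 × ℝ × (Fin (m + 1) → Rn (m + 1))) → ℝ≥0∞ :=
    fun p => ∏ i, F (swapAxis (p.1 : Rn (m + 1)) (embed m (tail (p.2.2 i)))) * slab (p.2.2 i 0)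
  have hFtail : ∀ i, Measurable fun p : Metric.sphere (0 : Rn (m + 1)) 1 × ℝ ×
      (Fin (m + 1) → Rn (m + 1)) => F (swapAxis (p.1 : Rn (m + 1)) (embed m (tail (p.2.2 i)))) := by
    intro i
    have h : Measurable fun p : Metric.sphere (0 : Rn (m + 1)) 1 × ℝ ×
      (Fin (m + 1) → Rn (m + 1)) => ((p.1 : Rn (m + 1)), tail (p.2.2 i)) :=
      (by fun_prop : Measurable fun p : Metric.sphere (0 : Rn (m + 1)) 1 × ℝ ×
        (Fin (m + 1) → Rn (m + 1)) => (p.1 : Rn (m + 1))).prodMk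
        (continuous_tail.measurable.comp (by fun_prop))
    have h' := hF.comp (measurable_sectionMap.comp h)
    exact h'
  have hslab : ∀ i, Measurable fun p : Metric.sphere (0 : Rn (m + 1)) 1 × ℝ ×
      (Fin (m + 1) → Rn (m + 1)) => slab (p.2.2 i 0) :=
    fun i => measurable_slab.comp (by fun_prop)
  have hG0m : Measurable G0 := Finset.measurable_prod _ fun i _ => (hFtail i).mul (hslab i)
  have hGm : ∀ s, Measurable (G s) := by
    intro s
    refine Measurable.mul ((continuous_Δ.measurable.comp (by fun_prop)).pow_const s)
      (Finset.measurable_prod _ fun i _ => Measurable.mul ?_ (hslab i))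
    have h : Measurable fun p : Metric.sphere (0 : Rn (m + 1)) 1 × ℝ ×
      (Fin (m + 1) → Rn (m + 1)) => ((p.1 : Rn (m + 1)), p.2.1 ^ (1 / s), p.2.2 i) := by fun_prop
    have h' := hop.comp ((hF.comp (measurable_rescaledArgument.comp h)).prodMk (hFtail i))
    exact h'
  have hiter : ∀ H : (Metric.sphere (0 : Rn (m + 1)) 1 × ℝ × (Fin (m + 1) → Rn (m + 1))) → ℝ≥0∞,
      Measurable H → ∫⁻ p, H p ∂(σ.prod (ν.prod volume)) =
        ∫⁻ θ, (∫⁻ τ, (∫⁻ z, H (θ, τ, z)) ∂ν) ∂σ := by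
    intro H hH
    rw [lintegral_prod _ hH.aemeasurable]
    refine lintegral_congr fun θ => ?_
    exact lintegral_prod _ (hH.comp measurable_prodMk_left).aemeasurable
  have hν1 : ν univ = 1 := by simp [hν]
  have hlimit : ∫⁻ p, G0 p ∂(σ.prod (ν.prod volume)) =
      ∫⁻ θ, sectionLIntegral F (θ : Rn (m + 1)) ^ (m + 1) ∂σ := by
    rw [hiter _ hG0m]
    refine lintegral_congr fun θ => ?_
    simp only [G0, lintegral_section_prod hF, lintegral_const, hν1, mul_one]
  have main : Tendsto (fun s => ∫⁻ p, G s p ∂(σ.prod (ν.prod volume))) (𝓝[>] 0)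
      (𝓝 (∫⁻ p, G0 p ∂(σ.prod (ν.prod volume)))) := by
    refine tendsto_lintegral_filter_of_dominated_convergence
      (fun p => C * ∏ i, B.indicator (fun _ => M) (p.2.2 i)) (Eventually.of_forall hGm) ?_ ?_ ?_
    · filter_upwards [Ioo_mem_nhdsGT (zero_lt_one : (0 : ℝ) < 1)] with s hs
      refine Eventually.of_forall fun p => ?_
      refine Δ_rpow_mul_prod_le hC1 hC hs.1.le hs.2.le _ (fun i => ?_) fun i hi => ?_
      · exact (mul_le_of_le_one_right' (slab_le_one _)).trans
          ((hop_le _ _).trans (max_le (hM _) (hM _)))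
      · have h1 := left_ne_zero_of_mul hi
        have h2 := right_ne_zero_of_mul hi
        refine norm_le_of_norm_tail_le hR0 ?_ ?_
        -- A nonzero `op` forces one of its arguments to be nonzero; either one bounds the common
        -- tail by R.
        · by_cases h3 : F (swapAxis (p.1 : Rn (m + 1)) (embed m (tail (p.2.2 i)))) = 0
          · have h4 : F (swapAxis (p.1 : Rn (m + 1)) (stretch m (p.2.1 ^ (1 / s)) (p.2.2 i))) ≠ 0 := by
              intro h4
              apply h1
              have := hop_le (F (swapAxis (p.1 : Rn (m + 1))
                (stretch m (p.2.1 ^ (1 / s)) (p.2.2 i))))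
                (F (swapAxis (p.1 : Rn (m + 1)) (embed m (tail (p.2.2 i)))))
              rw [h3, h4, max_self] at this
              rw [h3, h4]
              exact le_antisymm this zero_le
            have h5 := hR _ h4
            rw [LinearIsometryEquiv.norm_map] at h5
            refine le_trans ?_ h5
            refine le_trans (le_of_eq ?_) (norm_tail_le _)
            rw [stretch_eq_cons, tail_cons]
          · have h5 := hR _ h3
            rwa [LinearIsometryEquiv.norm_map, LinearIsometry.norm_map] at h5
        · by_contra h3
          exact h2 (indicator_of_notMem (by exact h3) _)
    · have hBm : Measurable (B.indicator fun _ => M) :=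
        measurable_const.indicator measurableSet_closedBall
      rw [hiter _ ((measurable_prod_apply hBm fun i => by fun_prop).const_mul C)]
      simp only [hB, lintegral_prod_closedBall, lintegral_const, hν1, mul_one]
      exact ENNReal.mul_ne_top (ENNReal.mul_ne_top hCt
        (ENNReal.pow_ne_top (ENNReal.mul_ne_top hMt measure_closedBall_lt_top.ne)))
        (measure_ne_top _ _)
    · have hz : ∀ᵐ p ∂(σ.prod (ν.prod (volume : Measure (Fin (m + 1) → Rn (m + 1))))),
          Δ p.2.2 ≠ 0 :=
        (Measure.quasiMeasurePreserving_snd.comp Measure.quasiMeasurePreserving_snd).ae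
          ae_Δ_ne_zero
      have hτ : ∀ᵐ p ∂(σ.prod (ν.prod (volume : Measure (Fin (m + 1) → Rn (m + 1))))),
          p.2.1 ∈ Ioo (0 : ℝ) 1 :=
        (Measure.quasiMeasurePreserving_fst.comp Measure.quasiMeasurePreserving_snd).ae
          (ae_restrict_mem measurableSet_Ioo)
      filter_upwards [hz, hτ] with p hp hτ
      have t1 : Tendsto (fun s : ℝ => Δ p.2.2 ^ s) (𝓝[>] 0) (𝓝 1) := by
        exact (tendsto_const_rpow_zero hp (Δ_ne_top _)).mono_left nhdsWithin_le_nhds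
      have t2 : Tendsto (fun s : ℝ => p.2.1 ^ (1 / s)) (𝓝[>] 0) (𝓝 0) := by
        have h := tendsto_rpow_atTop_of_base_lt_one p.2.1 (by linarith [hτ.1]) hτ.2
        simp only [one_div]
        exact h.comp tendsto_inv_nhdsGT_zero
      have t3 : Tendsto (fun s : ℝ => ∏ i, op (F (swapAxis (p.1 : Rn (m + 1))
          (stretch m (p.2.1 ^ (1 / s)) (p.2.2 i))))
          (F (swapAxis (p.1 : Rn (m + 1)) (embed m (tail (p.2.2 i))))) * slab (p.2.2 i 0)) (𝓝[>] 0)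
          (𝓝 (G0 p)) := by
        refine ENNReal.tendsto_finsetProd_of_ne_top _ (fun i _ => ?_) fun i _ => ?_
        · refine ENNReal.Tendsto.mul_const ((hlim _ _).comp t2) (Or.inr ?_)
          exact ne_top_of_le_ne_top ENNReal.one_ne_top (slab_le_one _)
        · exact ENNReal.mul_ne_top (ne_top_of_le_ne_top hMt (hM _))
            (ne_top_of_le_ne_top ENNReal.one_ne_top (slab_le_one _))
      have := ENNReal.Tendsto.mul t1 (Or.inl one_ne_zero) t3 (Or.inr ENNReal.one_ne_top)
      rw [one_mul] at this
      exact this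
  rw [hlimit] at main
  refine main.congr fun s => ?_
  rw [hiter _ (hGm s)]

end Limit

/-! ### The two semicontinuous inequalities. -/

section Bounds

variable {m : ℕ}

lemma J_eq {f : Rn (m + 1) → ℝ} (hf : Measurable f) {p : ℝ} (hp : -1 < p) :
    J f p = ((m + 1 : ℕ) : ℝ≥0∞)⁻¹ *
      (ENNReal.ofReal (p + 1) *
          (∫⁻ u in Metric.closedBall 0 1, slabIntegral (fun x => ENNReal.ofReal (f x)) (p + 1) u) +
        ∫⁻ θ, (∫⁻ τ in Ioo (0 : ℝ) 1, ∫⁻ z, rescaledIntegrand (fun x => ENNReal.ofReal (f x)) (p + 1)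
          (θ : Rn (m + 1)) (τ ^ (1 / (p + 1))) z) ∂(volume : Measure (Rn (m + 1))).toSphere) := by
  have hs : 0 < p + 1 := by linarith
  have hF : Measurable fun x => ENNReal.ofReal (f x) := by fun_prop
  rw [← lintegral_slabIntegral_eq hF hs, ← lintegral_Δ_rpow_eq_slabIntegral hF, ← mul_assoc, J,
    add_sub_cancel_right]
  congr 1
  rw [div_eq_inv_mul, ENNReal.ofReal_mul (by positivity),
    ENNReal.ofReal_inv_of_pos (by positivity), ENNReal.ofReal_natCast]

lemma tendsto_add_one_nhdsGT : Tendsto (fun p : ℝ => p + 1) (𝓝[>] (-1)) (𝓝[>] 0) := by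
  refine tendsto_nhdsWithin_iff.2 ⟨?_, ?_⟩
  · have : Tendsto (fun p : ℝ => p + 1) (𝓝 (-1)) (𝓝 (-1 + 1)) :=
      (continuous_add_const 1).tendsto _
    rw [neg_add_cancel] at this
    exact this.mono_left nhdsWithin_le_nhds
  · filter_upwards [self_mem_nhdsWithin] with p hp
    have : -1 < p := hp
    change 0 < p + 1
    linarith

lemma exists_bounds {f : Rn (m + 1) → ℝ} (hM : ∃ M : ℝ, ∀ x, f x ≤ M)
    (hc : HasCompactSupport f) : ∃ (M : ℝ≥0∞) (R : ℝ), M ≠ ∞ ∧ 0 ≤ R ∧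
      (∀ x, ENNReal.ofReal (f x) ≤ M) ∧ ∀ x, ENNReal.ofReal (f x) ≠ 0 → ‖x‖ ≤ R := by
  obtain ⟨M, hM⟩ := hM
  obtain ⟨R, hR⟩ := hc.isCompact.isBounded.subset_closedBall 0
  refine ⟨ENNReal.ofReal M, max R 0, ENNReal.ofReal_ne_top, le_max_right _ _,
    fun x => ENNReal.ofReal_le_ofReal (hM x), fun x hx => ?_⟩
  have : x ∈ Metric.closedBall (0 : Rn (m + 1)) R :=
    hR (subset_tsupport f fun h => hx (by rw [h, ENNReal.ofReal_zero]))
  exact (mem_closedBall_zero_iff.1 this).trans (le_max_left _ _)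

lemma sectionLIntegral_ne_top {f : Rn (m + 1) → ℝ} (hM : ∃ M : ℝ, ∀ x, f x ≤ M)
    (hc : HasCompactSupport f) (θ : Rn (m + 1)) :
    sectionLIntegral (fun x => ENNReal.ofReal (f x)) θ ≠ ∞ := by
  obtain ⟨M, R, hMt, -, hM, hR⟩ := exists_bounds hM hc
  exact ne_top_of_le_ne_top (ENNReal.mul_ne_top hMt measure_closedBall_lt_top.ne)
    (sectionLIntegral_le hM hR θ)

lemma volume_I_lt_top {f : Rn (m + 1) → ℝ} (hf : Measurable f) (h0 : ∀ x, 0 ≤ f x)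
    (hM : ∃ M : ℝ, ∀ x, f x ≤ M) (hc : HasCompactSupport f) : volume (I f) < ∞ := by
  rw [volume_I hf h0 (sectionLIntegral_ne_top hM hc)]
  obtain ⟨M, R, hMt, -, hM, hR⟩ := exists_bounds hM hc
  refine ENNReal.mul_lt_top (by simp) ?_
  refine (lintegral_mono fun θ => pow_le_pow_left' (sectionLIntegral_le hM hR _) _).trans_lt ?_
  rw [lintegral_const]
  exact ENNReal.mul_lt_top (ENNReal.pow_lt_top
    (ENNReal.mul_lt_top hMt.lt_top measure_closedBall_lt_top)) (measure_lt_top _ _)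

lemma tendsto_comp_stretch (θ z : Rn (m + 1)) :
    Tendsto (fun c => swapAxis θ (stretch m c z)) (𝓝 0) (𝓝 (swapAxis θ (embed m (tail z)))) :=
  ((swapAxis θ).continuous.tendsto _).comp (tendsto_stretch z)

/-- For lower semicontinuous `f`, the volume of `I f` is at most the lower limit of `J f`. -/
lemma volume_I_le_lowerI0 {f : Rn (m + 1) → ℝ} (hf : Measurable f) (h0 : ∀ x, 0 ≤ f x)
    (hM : ∃ M : ℝ, ∀ x, f x ≤ M) (hc : HasCompactSupport f) (hl : LowerSemicontinuous f) :
    volume (I f) ≤ lowerI0 f := by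
  rw [volume_I hf h0 (sectionLIntegral_ne_top hM hc)]
  obtain ⟨M, R, hMt, hR0, hM, hR⟩ := exists_bounds hM hc
  have hF : Measurable fun x => ENNReal.ofReal (f x) := by fun_prop
  have key := tendsto_lintegral_rescaled hF hMt hM hR hR0 (op := min)
    (measurable_fst.min measurable_snd) (fun a b => min_le_max) (fun θ z => by
      -- Lower semicontinuity supplies the bound from below; the minimum with the limiting value
      -- supplies the one from above.
      have h : Tendsto (fun c => min (f (swapAxis θ (stretch m c z)))
          (f (swapAxis θ (embed m (tail z))))) (𝓝 0) (𝓝 (f (swapAxis θ (embed m (tail z))))) := by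
        refine tendsto_order.2 ⟨fun a ha => ?_, fun b hb => ?_⟩
        · filter_upwards [(tendsto_comp_stretch θ z).eventually (hl _ a ha)] with c h
          exact lt_min h ha
        · exact Eventually.of_forall fun c => (min_le_right _ _).trans_lt hb
      refine (ENNReal.tendsto_ofReal h).congr fun c => ?_
      exact ENNReal.ofReal_mono.map_min)
  have key' := ENNReal.Tendsto.const_mul (key.comp tendsto_add_one_nhdsGT)
    (Or.inr (by simp : ((m + 1 : ℕ) : ℝ≥0∞)⁻¹ ≠ ∞))
  rw [← key'.liminf_eq, lowerI0]
  refine liminf_le_liminf ?_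
  filter_upwards [self_mem_nhdsWithin] with p hp
  rw [J_eq hf hp]
  -- For a lower bound the unit-ball term is simply discarded.
  refine mul_le_mul_right ((le_add_left ?_)) _
  refine lintegral_mono fun θ => lintegral_mono fun τ => lintegral_mono fun z => ?_
  refine mul_le_mul_right (Finset.prod_le_prod' fun i _ => ?_) _
  exact mul_le_mul_left (min_le_left _ _) _

/-- For upper semicontinuous `f`, the upper limit of `J f` is at most the volume of `I f`. -/
lemma upperI0_le_volume_I {f : Rn (m + 1) → ℝ} (hf : Measurable f) (h0 : ∀ x, 0 ≤ f x)
    (hM : ∃ M : ℝ, ∀ x, f x ≤ M) (hc : HasCompactSupport f) (hu : UpperSemicontinuous f) :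
    upperI0 f ≤ volume (I f) := by
  rw [volume_I hf h0 (sectionLIntegral_ne_top hM hc)]
  obtain ⟨M, R, hMt, hR0, hM, hR⟩ := exists_bounds hM hc
  have hF : Measurable fun x => ENNReal.ofReal (f x) := by fun_prop
  have key := tendsto_lintegral_rescaled hF hMt hM hR hR0 (op := max)
    (measurable_fst.max measurable_snd) (fun a b => le_rfl) (fun θ z => by
      have h : Tendsto (fun c => max (f (swapAxis θ (stretch m c z)))
          (f (swapAxis θ (embed m (tail z))))) (𝓝 0) (𝓝 (f (swapAxis θ (embed m (tail z))))) := by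
        refine tendsto_order.2 ⟨fun a ha => ?_, fun b hb => ?_⟩
        · exact Eventually.of_forall fun c => ha.trans_le (le_max_right _ _)
        · filter_upwards [(tendsto_comp_stretch θ z).eventually (hu _ b hb)] with c h
          exact max_lt h hb
      refine (ENNReal.tendsto_ofReal h).congr fun c => ?_
      exact ENNReal.ofReal_mono.map_max)
  obtain ⟨B, hBt, hB⟩ := exists_slabIntegral_le hMt hM hR
  set A := B * volume (Metric.closedBall (0 : Rn (m + 1)) 1) with hA
  have hAt : A ≠ ∞ := ENNReal.mul_ne_top hBt measure_closedBall_lt_top.ne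
  -- Here the unit-ball term must be kept; it is at most (p + 1)A, which tends to 0.
  have h1 : Tendsto (fun p : ℝ => ENNReal.ofReal (p + 1) * A) (𝓝[>] (-1)) (𝓝 0) := by
    have h := ENNReal.tendsto_ofReal (tendsto_add_one_nhdsGT.mono_right nhdsWithin_le_nhds)
    have h' := ENNReal.Tendsto.mul_const (b := A) h (Or.inr hAt)
    simpa using h'
  have key' := ENNReal.Tendsto.const_mul (h1.add (key.comp tendsto_add_one_nhdsGT))
    (Or.inr (by simp : ((m + 1 : ℕ) : ℝ≥0∞)⁻¹ ≠ ∞))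
  rw [zero_add] at key'
  rw [← key'.limsup_eq, upperI0]
  refine limsup_le_limsup ?_
  -- Restricting to p < 0 keeps s = p + 1 in (0,1), where the bound B is valid.
  filter_upwards [Ioo_mem_nhdsGT (by norm_num : (-1 : ℝ) < 0)] with p hp
  rw [J_eq hf hp.1]
  refine mul_le_mul_right (add_le_add (mul_le_mul_right ?_ _) ?_) _
  · rw [hA, ← setLIntegral_const]
    exact lintegral_mono fun u => hB _ (by linarith [hp.1]) (by linarith [hp.2]) u
  · refine lintegral_mono fun θ => lintegral_mono fun τ => lintegral_mono fun z => ?_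
    refine mul_le_mul_right (Finset.prod_le_prod' fun i _ => ?_) _
    exact mul_le_mul_left (le_max_left _ _) _

lemma lowerI0_mono {f g : Rn (m + 1) → ℝ} (h : ∀ x, f x ≤ g x) : lowerI0 f ≤ lowerI0 g := by
  refine liminf_le_liminf (Eventually.of_forall fun p => ?_)
  refine mul_le_mul_right (lintegral_mono fun x => mul_le_mul_right ?_ _) _
  exact Finset.prod_le_prod' fun i _ => ENNReal.ofReal_le_ofReal (h _)

end Bounds

/-! ### Null sets, their hyperplane sections and their radial slices. -/

section NullSets

variable {m : ℕ}

lemma volume_preimage_cons {N : Set (Rn (m + 1))} (hN : MeasurableSet N) :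
    volume {p : ℝ × Rn m | cons p.1 p.2 ∈ N} = volume N := by
  have hN' : MeasurableSet {p : ℝ × Rn m | cons p.1 p.2 ∈ N} := continuous_cons.measurable hN
  rw [← measurePreserving_head_tail.measure_preimage hN'.nullMeasurableSet]
  congr 1
  ext z
  simp

/-- The hyperplane orthogonal to a vector with nonzero first coordinate, as a graph. -/
def graphPoint (u : Rn (m + 1)) (y : Rn m) : Rn (m + 1) := cons (-(inner ℝ (tail u) y) / u 0) y

lemma measurable_graphPoint :
    Measurable fun p : Rn (m + 1) × Rn m => graphPoint p.1 p.2 := by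
  have h : Measurable fun p : Rn (m + 1) × Rn m => (-(inner ℝ (tail p.1) p.2) / p.1 0, p.2) := by
    have : Measurable fun p : Rn (m + 1) × Rn m => tail p.1 :=
      continuous_tail.measurable.comp measurable_fst
    fun_prop
  have h' := continuous_cons.measurable.comp h
  exact h'

/-- By Fubini, fix y and vary u. For y ≠ 0 and fixed u₀ ≠ 0, the height of the graph over y is a
nonzero linear functional of the tail of u, so it pulls null sets back to null sets. Ambient
dimension at least 2 makes y ≠ 0 almost sure; on the line the section {0} would be a counterexample.
-/
lemma ae_ae_graphPoint_notMem {N : Set (Rn (m + 2))} (hN : MeasurableSet N)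
    (h0 : volume N = 0) : ∀ᵐ u : Rn (m + 2), ∀ᵐ y : Rn (m + 1), graphPoint u y ∉ N := by
  have hms : MeasurableSet {p : Rn (m + 2) × Rn (m + 1) | graphPoint p.1 p.2 ∉ N} :=
    (measurable_graphPoint hN).compl
  rw [Measure.ae_ae_comm hms]
  have hN' : MeasurableSet {p : ℝ × Rn (m + 1) | cons p.1 p.2 ∉ N} :=
    (continuous_cons.measurable hN).compl
  have h1 : ∀ᵐ p : ℝ × Rn (m + 1), cons p.1 p.2 ∉ N := by
    rw [ae_iff]
    simpa using (volume_preimage_cons hN).trans h0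
  have h2 : ∀ᵐ y : Rn (m + 1), ∀ᵐ t : ℝ, cons t y ∉ N :=
    (Measure.ae_ae_comm hN').1 (Measure.ae_ae_of_ae_prod h1)
  have h3 : ∀ᵐ y : Rn (m + 1), y ≠ 0 := by simp [ae_iff]
  filter_upwards [h2, h3] with y hy hy0
  have hNy : MeasurableSet {t : ℝ | cons t y ∉ N} :=
    (measurable_prodMk_right (y := y)) hN'
  have hmeas : MeasurableSet {p : ℝ × Rn (m + 1) | cons (-(inner ℝ p.2 y) / p.1) y ∉ N} := by
    have : Measurable fun p : ℝ × Rn (m + 1) => -(inner ℝ p.2 y) / p.1 := by fun_prop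
    exact this hNy
  have h4 : ∀ᵐ p : ℝ × Rn (m + 1), cons (-(inner ℝ p.2 y) / p.1) y ∉ N := by
    rw [Measure.volume_eq_prod, Measure.ae_prod_iff_ae_ae hmeas]
    have h5 : ∀ᵐ c : ℝ, c ≠ 0 := by simp [ae_iff]
    filter_upwards [h5] with c hc
    let L : Rn (m + 1) →ₗ[ℝ] ℝ := (-(1 / c)) • (innerₛₗ ℝ y)
    have hL : Function.Surjective L := by
      intro t
      refine ⟨(-(c * t) / ‖y‖ ^ 2) • y, ?_⟩
      have : ‖y‖ ≠ 0 := norm_ne_zero_iff.2 hy0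
      simp [L]
      field_simp
    have h6 := (ae_comp_linearMap_mem_iff L (volume : Measure (Rn (m + 1)))
      (volume : Measure ℝ) hL hNy).2 hy
    filter_upwards [h6] with b hb
    have : L b = -(inner ℝ b y) / c := by
      simp [L, real_inner_comm]
      ring
    rw [← this]
    exact hb
  exact measurePreserving_head_tail.quasiMeasurePreserving.ae h4

/-- The spherical measure of a set is, up to the dimension factor, the volume of the cone over it.
-/
lemma ae_toSphere_of_ae {p : Rn (m + 1) → Prop} (hp : MeasurableSet {x | p x})
    (h : ∀ᵐ x : Rn (m + 1), p (‖x‖⁻¹ • x)) :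
    ∀ᵐ θ : Metric.sphere (0 : Rn (m + 1)) 1 ∂(volume : Measure (Rn (m + 1))).toSphere,
      p (θ : Rn (m + 1)) := by
  have hms : MeasurableSet {θ : Metric.sphere (0 : Rn (m + 1)) 1 | ¬ p θ} :=
    measurable_subtype_coe hp.compl
  rw [ae_iff, Measure.toSphere_apply' _ hms]
  refine mul_eq_zero_of_right _ (measure_mono_null ?_ h)
  rintro _ ⟨r, hr, _, ⟨θ, hθ, rfl⟩, rfl⟩
  have hr0 : 0 < r := hr.1
  have : ‖r • (θ : Rn (m + 1))‖⁻¹ • r • (θ : Rn (m + 1)) = θ := by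
    simp [norm_smul, smul_smul, abs_of_pos hr0, hr0.ne']
  change ¬ p (‖r • (θ : Rn (m + 1))‖⁻¹ • r • (θ : Rn (m + 1)))
  rw [this]
  exact hθ

/-- The hyperplane u^⊥ is parametrized both isometrically and as a graph; the transition map L is
linear and injective, so it respects null sets. -/
lemma sectionLIntegral_indicator_eq_zero {N : Set (Rn (m + 1))} (hN : MeasurableSet N)
    {u : Rn (m + 1)} (hu : u 0 ≠ 0) (h : ∀ᵐ y : Rn m, graphPoint u y ∉ N) :
    sectionLIntegral (N.indicator 1) (‖u‖⁻¹ • u) = 0 := by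
  set θ := ‖u‖⁻¹ • u with hθ
  have hu0 : u ≠ 0 := by rintro rfl; exact hu rfl
  have hun : 0 < ‖u‖ := norm_pos_iff.2 hu0
  have hθ1 : ‖θ‖ = 1 := by simp [hθ, norm_smul, hun.ne']
  have hgraph : ∀ y : Rn m, graphPoint u (tail (swapAxis θ (embed m y))) =
      swapAxis θ (embed m y) := by
    intro y
    set x := swapAxis θ (embed m y)
    have h1 : inner ℝ θ x = 0 := by rw [inner_swapAxis hθ1, embed_apply, cons_zero]
    have h2 : inner ℝ u x = 0 := by
      rw [hθ, real_inner_smul_left] at h1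
      exact (mul_eq_zero.1 h1).resolve_left (inv_ne_zero hun.ne')
    have h3 : u 0 * x 0 + inner ℝ (tail u) (tail x) = 0 := by
      rw [← h2]
      simp [PiLp.inner_apply, Fin.sum_univ_succ, mul_comm]
    have h4 : -(inner ℝ (tail u) (tail x)) / u 0 = x 0 := by
      rw [div_eq_iff hu]; linarith
    rw [graphPoint, h4, cons_tail]
  let tailₗ : Rn (m + 1) →ₗ[ℝ] Rn m :=
    { toFun := tail, map_add' := fun _ _ => rfl, map_smul' := fun _ _ => rfl }
  let L : Rn m →ₗ[ℝ] Rn m :=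
    tailₗ ∘ₗ ((swapAxis θ).toLinearEquiv : _ →ₗ[ℝ] _) ∘ₗ (embed m).toLinearMap
  have hLa : ∀ y, L y = tail (swapAxis θ (embed m y)) := fun y => rfl
  have hinj : Function.Injective L := by
    intro y y' hy
    rw [hLa, hLa] at hy
    have := hgraph y
    rw [hy, hgraph y'] at this
    exact (embed m).injective ((swapAxis θ).injective this.symm)
  have hdet : LinearMap.det L ≠ 0 :=
    (LinearMap.isUnit_det L ((LinearMap.isUnit_iff_ker_eq_bot L).2
      (LinearMap.ker_eq_bot.2 hinj))).ne_zero
  have hnull : volume {y | graphPoint u y ∈ N} = 0 := by simpa [ae_iff] using h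
  have hA : MeasurableSet {y | swapAxis θ (embed m y) ∈ N} := measurable_sectionMap_right θ hN
  have : sectionLIntegral (N.indicator 1) θ = volume {y | swapAxis θ (embed m y) ∈ N} := by
    rw [← lintegral_indicator_one hA]
    rfl
  rw [this]
  refine measure_mono_null (t := L ⁻¹' {y | graphPoint u y ∈ N}) (fun y hy => ?_) ?_
  · change graphPoint u (L y) ∈ N
    rw [hLa, hgraph]
    exact hy
  · rw [Measure.addHaar_preimage_linearMap _ hdet, hnull, mul_zero]

/-- Almost every hyperplane section of a null set is null. -/
lemma ae_sectionLIntegral_indicator_eq_zero {N : Set (Rn (m + 2))} (hN : MeasurableSet N)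
    (h0 : volume N = 0) :
    ∀ᵐ θ : Metric.sphere (0 : Rn (m + 2)) 1 ∂(volume : Measure (Rn (m + 2))).toSphere,
      sectionLIntegral (N.indicator 1) (θ : Rn (m + 2)) = 0 := by
  have hm : Measurable (sectionLIntegral (N.indicator (1 : Rn (m + 2) → ℝ≥0∞))) :=
    measurable_sectionLIntegral (measurable_one.indicator hN)
  refine ae_toSphere_of_ae (p := fun x => sectionLIntegral (N.indicator 1) x = 0)
    (hm (measurableSet_singleton 0)) ?_
  have h1 : ∀ᵐ u : Rn (m + 2), u 0 ≠ 0 := by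
    have h5 : ∀ᵐ p : ℝ × Rn (m + 1), p.1 ≠ 0 :=
      Measure.quasiMeasurePreserving_fst.ae (p := fun t : ℝ => t ≠ 0) (by simp [ae_iff])
    exact measurePreserving_head_tail.quasiMeasurePreserving.ae h5
  filter_upwards [h1, ae_ae_graphPoint_notMem hN h0] with u hu hu'
  exact sectionLIntegral_indicator_eq_zero hN hu hu'

lemma volume_le_euclideanHausdorffMeasure_ray (N : Set (Rn (m + 1))) {θ : Rn (m + 1)}
    (hθ : ‖θ‖ = 1) : volume {t : ℝ | 0 < t ∧ t • θ ∈ N} ≤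
      Measure.euclideanHausdorffMeasure 1 (N ∩ ray θ) := by
  have hi : Isometry fun t : ℝ => t • θ :=
    Isometry.of_dist_eq fun a b => by
      rw [dist_eq_norm, ← sub_smul, norm_smul, hθ, mul_one, dist_eq_norm]
  have h1 : (volume : Measure ℝ) = Measure.euclideanHausdorffMeasure 1 := by
    rw [← InnerProductSpace.euclideanHausdorffMeasure_eq_volume, Module.finrank_self]
  rw [h1, ← hi.euclideanHausdorffMeasure_image]
  refine measure_mono ?_
  rintro _ ⟨t, ⟨ht, htN⟩, rfl⟩
  exact ⟨htN, t, ht.le, rfl⟩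

/-- Almost every ray meets the boundary in a set of length zero, and polar coordinates integrate
these slices. The Hausdorff slice lengths are first replaced by smaller Lebesgue ones, whose
measurability in θ follows from Fubini, so that a zero integral gives vanishing almost everywhere.
-/
lemma volume_frontier_eq_zero {K : Set (Rn (m + 1))} (h : RadiallyNegligibleBoundary K) :
    volume (frontier K) = 0 := by
  set N := frontier K
  have hN : MeasurableSet N := isClosed_frontier.measurableSet
  set σ := (volume : Measure (Rn (m + 1))).toSphere with hσ
  have h1 : ∫⁻ θ : Metric.sphere (0 : Rn (m + 1)) 1,
      Measure.euclideanHausdorffMeasure 1 (N ∩ ray (θ : Rn (m + 1))) ∂σ = 0 := by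
    have := h
    rw [RadiallyNegligibleBoundary, sphereProb, lintegral_smul_measure, smul_eq_mul] at this
    exact (mul_eq_zero.1 this).resolve_left (ENNReal.inv_ne_zero.2 (measure_ne_top _ _))
  have hm : Measurable fun p : Metric.sphere (0 : Rn (m + 1)) 1 × ℝ => p.2 • (p.1 : Rn (m + 1)) := by
    fun_prop
  have hset : MeasurableSet {p : Metric.sphere (0 : Rn (m + 1)) 1 × ℝ |
      0 < p.2 ∧ p.2 • (p.1 : Rn (m + 1)) ∈ N} :=
    (measurableSet_lt measurable_const measurable_snd).inter (hm hN)
  have h2 : ∫⁻ θ : Metric.sphere (0 : Rn (m + 1)) 1,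
      volume {t : ℝ | 0 < t ∧ t • (θ : Rn (m + 1)) ∈ N} ∂σ = 0 := by
    refine le_antisymm (le_trans (lintegral_mono fun θ => ?_) h1.le) zero_le
    exact volume_le_euclideanHausdorffMeasure_ray N (by simp)
  have h3 := (lintegral_eq_zero_iff (measurable_measure_prodMk_left hset)).1 h2
  rw [← lintegral_indicator_one hN, lintegral_polar volume _ (measurable_one.indicator hN),
    ← lintegral_zero (μ := σ)]
  refine lintegral_congr_ae ?_
  filter_upwards [h3] with θ hθ
  rw [← lintegral_zero (μ := volume.restrict (Ioi (0 : ℝ)))]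
  refine lintegral_congr_ae ((ae_restrict_iff' measurableSet_Ioi).2 ?_)
  have hθ' : ∀ᵐ t : ℝ, ¬ (0 < t ∧ t • (θ : Rn (m + 1)) ∈ N) := by
    rw [ae_iff]
    simpa using hθ
  filter_upwards [hθ'] with t ht ht0
  rw [indicator_of_notMem fun h => ht ⟨ht0, h⟩, mul_zero]

end NullSets

/-! ### Indicators of compact sets. -/

section Indicators

variable {n m : ℕ}

lemma measurable_ind {K : Set (Rn n)} (hK : MeasurableSet K) : Measurable (ind K) :=
  measurable_const.indicator hK

lemma ind_nonneg (K : Set (Rn n)) (x : Rn n) : 0 ≤ ind K x :=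
  indicator_nonneg (fun _ _ => zero_le_one) x

lemma ind_le_one (K : Set (Rn n)) (x : Rn n) : ind K x ≤ 1 :=
  indicator_le_self' (fun _ _ => zero_le_one) x

lemma ind_mono {K K' : Set (Rn n)} (h : K ⊆ K') (x : Rn n) : ind K x ≤ ind K' x :=
  indicator_le_indicator_of_subset h (fun _ => zero_le_one) x

lemma hasCompactSupport_ind {A K : Set (Rn n)} (hK : IsCompact K) (h : A ⊆ K) :
    HasCompactSupport (ind A) :=
  HasCompactSupport.intro hK fun _ hx => indicator_of_notMem (fun hA => hx (h hA)) _

lemma ofReal_ind (K : Set (Rn n)) (x : Rn n) :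
    ENNReal.ofReal (ind K x) = K.indicator 1 x := by
  by_cases h : x ∈ K <;> simp [ind, h]

/-- A compact set with null boundary has the same intersection body volume as its interior. -/
lemma volume_I_ind_interior {K : Set (Rn (m + 2))} (hK : IsCompact K)
    (h0 : volume (frontier K) = 0) : volume (I (ind (interior K))) = volume (I (ind K)) := by
  rw [volume_I (measurable_ind isOpen_interior.measurableSet) (ind_nonneg _)
      (sectionLIntegral_ne_top ⟨1, ind_le_one _⟩ (hasCompactSupport_ind hK interior_subset)),
    volume_I (measurable_ind hK.measurableSet) (ind_nonneg _)
      (sectionLIntegral_ne_top ⟨1, ind_le_one _⟩ (hasCompactSupport_ind hK subset_rfl))]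
  congr 1
  refine lintegral_congr_ae ?_
  filter_upwards [ae_sectionLIntegral_indicator_eq_zero
    isClosed_frontier.measurableSet h0] with θ hθ
  congr 1
  refine le_antisymm (lintegral_mono fun y => ENNReal.ofReal_le_ofReal
    (ind_mono interior_subset _)) ?_
  have hm : Measurable fun y => (frontier K).indicator (1 : Rn (m + 2) → ℝ≥0∞)
      (swapAxis (θ : Rn (m + 2)) (embed (m + 1) y)) := by
    have h := (measurable_one.indicator (isClosed_frontier (s := K)).measurableSet :
      Measurable ((frontier K).indicator (1 : Rn (m + 2) → ℝ≥0∞))).comp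
        (measurable_sectionMap_right (θ : Rn (m + 2)))
    exact h
  -- Pointwise 1_K is at most the sum of the indicators of the interior and of the boundary, and the
  -- latter integrates to zero on this section.
  calc sectionLIntegral (fun x => ENNReal.ofReal (ind K x)) (θ : Rn (m + 2))
      ≤ ∫⁻ y, (ENNReal.ofReal (ind (interior K) (swapAxis (θ : Rn (m + 2)) (embed (m + 1) y))) +
          (frontier K).indicator 1 (swapAxis (θ : Rn (m + 2)) (embed (m + 1) y))) := by
        refine lintegral_mono fun y => ?_
        simp only [ofReal_ind]
        set x := swapAxis (θ : Rn (m + 2)) (embed (m + 1) y)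
        by_cases hx : x ∈ K
        · by_cases hi : x ∈ interior K
          · simp [hx, hi]
          · have : x ∈ frontier K := ⟨subset_closure hx, hi⟩
            simp [hx, this]
        · simp [hx]
    _ = sectionLIntegral (fun x => ENNReal.ofReal (ind (interior K) x)) (θ : Rn (m + 2)) := by
        rw [lintegral_add_right _ hm]
        have : ∫⁻ y, (frontier K).indicator (1 : Rn (m + 2) → ℝ≥0∞)
          (swapAxis (θ : Rn (m + 2)) (embed (m + 1) y)) = 0 := hθ
        rw [this, add_zero, sectionLIntegral]

lemma upperI0_ind_le_volume_I {K : Set (Rn (m + 1))} (hK : IsCompact K) :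
    upperI0 (ind K) ≤ volume (I (ind K)) :=
  upperI0_le_volume_I (measurable_ind hK.measurableSet) (ind_nonneg K) ⟨1, ind_le_one K⟩
    (hasCompactSupport_ind hK subset_rfl) (hK.isClosed.upperSemicontinuous_indicator zero_le_one)

lemma volume_I_ind_lt_top {K : Set (Rn (m + 1))} (hK : IsCompact K) : volume (I (ind K)) < ∞ :=
  volume_I_lt_top (measurable_ind hK.measurableSet) (ind_nonneg K) ⟨1, ind_le_one K⟩
    (hasCompactSupport_ind hK subset_rfl)

/-- 1_K itself is only upper semicontinuous; the indicator of the interior is lower semicontinuous,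
has the same |I|, and lies below 1_K. -/
lemma volume_I_le_lowerI0_ind {K : Set (Rn (m + 2))} (hK : IsCompact K)
    (h0 : volume (frontier K) = 0) : volume (I (ind K)) ≤ lowerI0 (ind K) := by
  rw [← volume_I_ind_interior hK h0]
  exact (volume_I_le_lowerI0 (measurable_ind isOpen_interior.measurableSet) (ind_nonneg _)
    ⟨1, ind_le_one _⟩ (hasCompactSupport_ind hK interior_subset)
    (isOpen_interior.lowerSemicontinuous_indicator zero_le_one)).trans
      (lowerI0_mono (ind_mono interior_subset))

end Indicators

end IntersectionBody

end

/-! ### Assembly: each limit is squeezed between the lower and upper bounds. -/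

theorem theorem3p2 (n : ℕ) (hn : 2 ≤ n) :
    (∀ f : IntersectionBody.Rn n → ℝ,
      Measurable f → (∀ x, 0 ≤ f x) → (∃ M : ℝ, ∀ x, f x ≤ M) → HasCompactSupport f →
        (LowerSemicontinuous f →
          volume (IntersectionBody.I f) ≤ IntersectionBody.lowerI0 f) ∧
        (UpperSemicontinuous f →
          IntersectionBody.upperI0 f ≤ volume (IntersectionBody.I f)) ∧
        (Continuous f →
          volume (IntersectionBody.I f) < ∞ ∧
          Tendsto (IntersectionBody.J f) (𝓝[>] (-1 : ℝ)) (𝓝 (volume (IntersectionBody.I f))))) ∧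
    (∀ K : Set (IntersectionBody.Rn n), IsCompact K →
        IntersectionBody.upperI0 (IntersectionBody.ind K) ≤
          volume (IntersectionBody.I (IntersectionBody.ind K)) ∧
        (IntersectionBody.RadiallyNegligibleBoundary K →
          volume (IntersectionBody.I (IntersectionBody.ind K)) < ∞ ∧
          Tendsto (IntersectionBody.J (IntersectionBody.ind K)) (𝓝[>] (-1 : ℝ))
            (𝓝 (volume (IntersectionBody.I (IntersectionBody.ind K)))))) := by
  obtain ⟨m, rfl⟩ := Nat.exists_eq_add_of_le' hn
  refine ⟨fun f hf h0 hM hc => ?_, fun K hK => ?_⟩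
  · exact ⟨IntersectionBody.volume_I_le_lowerI0 hf h0 hM hc,
      IntersectionBody.upperI0_le_volume_I hf h0 hM hc, fun hcont =>
        ⟨IntersectionBody.volume_I_lt_top hf h0 hM hc, tendsto_of_le_liminf_of_limsup_le
          (IntersectionBody.volume_I_le_lowerI0 hf h0 hM hc hcont.lowerSemicontinuous)
          (IntersectionBody.upperI0_le_volume_I hf h0 hM hc hcont.upperSemicontinuous)⟩⟩
  · exact ⟨IntersectionBody.upperI0_ind_le_volume_I hK, fun hrad =>
      ⟨IntersectionBody.volume_I_ind_lt_top hK, tendsto_of_le_liminf_of_limsup_le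
        (IntersectionBody.volume_I_le_lowerI0_ind hK (IntersectionBody.volume_frontier_eq_zero hrad))
        (IntersectionBody.upperI0_ind_le_volume_I hK)⟩⟩
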